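/- **Lemma (descent along a cyclic cover).** Let $X$ be a normal complex algebraic variety (integral, separated, of finite type over $\mathbb C$; for instance a normal connected projective variety) with tangent sheaf $T_X=\mathcal{D}er_{\mathbb C}(\mathcal O_X)=\mathcal Hom(\Omega^1_X,\mathcal O_X)$. Let $H$ be a line bundle on $X$, $g\ge 1$ an integer, and $s$ a nonzero global section of $H^{\otimes g}$ whose divisor of zeros is reduced, i.e. $s$ vanishes to order at most one along every prime divisor of $X$. (For an orbifold pair $(X,\Delta)$ with $\Delta=\sum_j(1-\frac{b_j}{a_j})D_j$, one takes $H$ very ample, $g$ divisible by $a_j$ for each $D_j$ of finite multiplicity $a_j/b_j>1$, and $s$ with reduced zero divisor $Z+\sum_j D_j$, the sum being over these $j$.) Let $\pi:Y\to X$ be the normalization of the cyclic cover of degree $g$ associated to $s$; that is, choosing a rational trivialization of $H$ and regarding $s$ as a rational function, $Y$ is the normalization of $X$ in $\mathbb C(X)[T]/(T^g-s)$. Let $G=\mu_g\cong\mathbb Z_g$ act on $Y$ over $X$ by $T\mapsto\zeta T$, and hence on $\pi^*T_X$. Let $\mathcal F\subset\pi^*T_X$ be a coherent $\mathcal O_Y$-submodule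 which is $G$-invariant (the canonical isomorphism $\sigma^*\pi^*T_X\cong\pi^*T_X$ maps $\sigma^*\mathcal F$ onto $\mathcal F$ for every $\sigma\in G$) and saturated (the quotient $\pi^*T_X/\mathcal F$ is torsion free). Then there is a coherent $\mathcal O_X$-submodule $\mathcal F_X\subset T_X$ such that $\mathcal F=\pi^*\mathcal F_X$ as submodules of $\pi^*T_X$. -/

import Mathlib

open CategoryTheory AlgebraicGeometry Opposite TopologicalSpace

noncomputable section

namespace CyclicDescent

universe u

/-! ### The relative tangent sheaf -/

/-- A section over `U` of the relative tangent sheaf of `f : X ⟶ S`: a derivation of the sheaf of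
rings `𝒪_U` into itself which vanishes on the functions coming from `S`, that is, a family of
derivations `Γ(X, V) → Γ(X, V)` for `V ≤ U`, compatible with restriction. -/
@[ext]
structure VectorField {X S : Scheme.{u}} (f : X ⟶ S) (U : X.Opens) where
  toFun : ∀ V : X.Opens, V ≤ U → Γ(X, V) → Γ(X, V)
  map_add' : ∀ V hV a b, toFun V hV (a + b) = toFun V hV a + toFun V hV b
  leibniz' : ∀ V hV a b, toFun V hV (a * b) = a * toFun V hV b + b * toFun V hV a
  map_base' : ∀ V hV (W : S.Opens) (h : V ≤ f ⁻¹ᵁ W) (c : Γ(S, W)),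
    toFun V hV ((f.appLE W V h).hom c) = 0
  res' : ∀ V hV W (hWV : W ≤ V) (a : Γ(X, V)),
    X.presheaf.map (homOfLE hWV).op (toFun V hV a) =
      toFun W (hWV.trans hV) (X.presheaf.map (homOfLE hWV).op a)

namespace VectorField

variable {X S : Scheme.{u}} {f : X ⟶ S} {U : X.Opens}

instance : Zero (VectorField f U) :=
  ⟨⟨fun _ _ _ => 0, by simp, by simp, by simp, by simp⟩⟩

instance : Add (VectorField f U) :=
  ⟨fun D E => ⟨fun V hV a => D.toFun V hV a + E.toFun V hV a,
    fun V hV a b => by rw [D.map_add', E.map_add']; abel,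
    fun V hV a b => by rw [D.leibniz', E.leibniz']; ring,
    fun V hV W h c => by rw [D.map_base', E.map_base', add_zero],
    fun V hV W hWV a => by rw [map_add, D.res', E.res']⟩⟩

instance : Neg (VectorField f U) :=
  ⟨fun D => ⟨fun V hV a => - D.toFun V hV a,
    fun V hV a b => by rw [D.map_add']; abel,
    fun V hV a b => by rw [D.leibniz']; ring,
    fun V hV W h c => by rw [D.map_base', neg_zero],
    fun V hV W hWV a => by rw [map_neg, D.res']⟩⟩

/-- Multiplication of a vector field over `U` by a function on `U`. -/
instance : SMul Γ(X, U) (VectorField f U) :=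
  ⟨fun r D => ⟨fun V hV a => X.presheaf.map (homOfLE hV).op r * D.toFun V hV a,
    fun V hV a b => by rw [D.map_add']; ring,
    fun V hV a b => by rw [D.leibniz']; ring,
    fun V hV W h c => by rw [D.map_base', mul_zero],
    fun V hV W hWV a => by
      rw [map_mul, D.res', ← CommRingCat.comp_apply, ← Functor.map_comp]; rfl⟩⟩

lemma add_toFun (D E : VectorField f U) (V : X.Opens) (hV : V ≤ U) (a : Γ(X, V)) :
    (D + E).toFun V hV a = D.toFun V hV a + E.toFun V hV a := rfl

lemma zero_toFun (V : X.Opens) (hV : V ≤ U) (a : Γ(X, V)) :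
    (0 : VectorField f U).toFun V hV a = 0 := rfl

lemma smul_toFun (r : Γ(X, U)) (D : VectorField f U) (V : X.Opens) (hV : V ≤ U) (a : Γ(X, V)) :
    (r • D).toFun V hV a = X.presheaf.map (homOfLE hV).op r * D.toFun V hV a := rfl

lemma neg_toFun (D : VectorField f U) (V : X.Opens) (hV : V ≤ U) (a : Γ(X, V)) :
    (-D).toFun V hV a = - D.toFun V hV a := rfl

instance : AddCommGroup (VectorField f U) where
  add_assoc D E F := by ext V hV a; simp only [add_toFun, add_assoc]
  zero_add D := by ext V hV a; simp only [add_toFun, zero_toFun, zero_add]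
  add_zero D := by ext V hV a; simp only [add_toFun, zero_toFun, add_zero]
  neg_add_cancel D := by ext V hV a; simp only [add_toFun, neg_toFun, zero_toFun, neg_add_cancel]
  add_comm D E := by ext V hV a; simp only [add_toFun, add_comm]
  nsmul := nsmulRec
  zsmul := zsmulRec

instance : Module Γ(X, U) (VectorField f U) where
  one_smul D := by ext V hV a; simp only [smul_toFun, map_one, one_mul]
  mul_smul r s D := by ext V hV a; simp only [smul_toFun, map_mul, mul_assoc]
  smul_zero r := by ext V hV a; exact mul_zero _
  smul_add r D E := by ext V hV a; exact mul_add _ _ _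
  add_smul r s D := by
    ext V hV a
    change X.presheaf.map (homOfLE hV).op (r + s) * D.toFun V hV a = _
    rw [map_add, add_mul]; rfl
  zero_smul D := by
    ext V hV a
    change X.presheaf.map (homOfLE hV).op 0 * D.toFun V hV a = _
    rw [map_zero, zero_mul]; rfl

/-- Restriction of vector fields to a smaller open set. -/
def restrict {U' : X.Opens} (h : U' ≤ U) : VectorField f U →+ VectorField f U' where
  toFun D := ⟨fun V hV => D.toFun V (hV.trans h), fun V hV => D.map_add' V _,
    fun V hV => D.leibniz' V _, fun V hV => D.map_base' V _,
    fun V hV W hWV => D.res' V _ W hWV⟩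
  map_zero' := by ext; rfl
  map_add' _ _ := by ext; rfl

lemma restrict_toFun {U' : X.Opens} (h : U' ≤ U) (D : VectorField f U) (V : X.Opens)
    (hV : V ≤ U') (a : Γ(X, V)) : (restrict h D).toFun V hV a = D.toFun V (hV.trans h) a := rfl

end VectorField

/-- The presheaf of abelian groups underlying the relative tangent sheaf. -/
def tangentPresheaf {X S : Scheme.{u}} (f : X ⟶ S) : TopCat.Presheaf Ab.{u} X where
  obj U := AddCommGrpCat.of (VectorField f U.unop)
  map i := AddCommGrpCat.ofHom (VectorField.restrict i.unop.le)
  map_id _ := by ext : 2; rfl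
  map_comp _ _ := by ext : 2; rfl

/-- A function is determined by its restrictions to the `V ⊓ U i`, if `V ≤ ⨆ i, U i`. -/
lemma section_ext {X : Scheme.{u}} {ι : Type u} (U : ι → X.Opens) (V : X.Opens)
    (hV : V ≤ iSup U) (a b : Γ(X, V))
    (h : ∀ i, X.presheaf.map (homOfLE (inf_le_left : V ⊓ U i ≤ V)).op a =
      X.presheaf.map (homOfLE (inf_le_left : V ⊓ U i ≤ V)).op b) : a = b :=
  X.sheaf.eq_of_locally_eq' (fun i => V ⊓ U i) V (fun i => homOfLE inf_le_left)
    (by rw [← inf_iSup_eq]; exact le_inf le_rfl hV) a b h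

lemma tangentPresheaf_isSheaf {X S : Scheme.{u}} (f : X ⟶ S) : (tangentPresheaf f).IsSheaf := by
  rw [TopCat.Presheaf.isSheaf_iff_isSheafUniqueGluing]
  intro ι U D hD
  replace hD : ∀ i j (V : X.Opens) (hi : V ≤ U i) (hj : V ≤ U j) (a : Γ(X, V)),
      VectorField.toFun (D i) V hi a = VectorField.toFun (D j) V hj a := by
    intro i j V hi hj a
    exact congrArg (fun E : VectorField f (U i ⊓ U j) => E.toFun V (le_inf hi hj) a) (hD i j)
  have key : ∀ (V : X.Opens) (hV : V ≤ iSup U) (a : Γ(X, V)), ∃ b : Γ(X, V), ∀ i,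
      X.presheaf.map (homOfLE (inf_le_left : V ⊓ U i ≤ V)).op b =
        VectorField.toFun (D i) (V ⊓ U i) inf_le_right
          (X.presheaf.map (homOfLE (inf_le_left : V ⊓ U i ≤ V)).op a) := by
    intro V hV a
    obtain ⟨b, hb, -⟩ := X.sheaf.existsUnique_gluing' (fun i => V ⊓ U i) V
      (fun i => homOfLE inf_le_left) (by rw [← inf_iSup_eq]; exact le_inf le_rfl hV)
      (fun i => VectorField.toFun (D i) (V ⊓ U i) inf_le_right
          (X.presheaf.map (homOfLE (inf_le_left : V ⊓ U i ≤ V)).op a)) (by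
        intro i j
        have h1 := VectorField.res' (D i) (V ⊓ U i) inf_le_right ((V ⊓ U i) ⊓ (V ⊓ U j))
          inf_le_left (X.presheaf.map (homOfLE (inf_le_left : V ⊓ U i ≤ V)).op a)
        have h2 := VectorField.res' (D j) (V ⊓ U j) inf_le_right ((V ⊓ U i) ⊓ (V ⊓ U j))
          inf_le_right (X.presheaf.map (homOfLE (inf_le_left : V ⊓ U j ≤ V)).op a)
        refine h1.trans (Eq.trans ?_ h2.symm)
        rw [← CommRingCat.comp_apply, ← CommRingCat.comp_apply, ← Functor.map_comp,
          ← Functor.map_comp]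
        exact hD i j _ _ _ _)
    exact ⟨b, hb⟩
  choose E hE using key
  have hE' : ∀ (V : X.Opens) (hV : V ≤ iSup U) (W : X.Opens) (hWV : W ≤ V) (i : ι)
      (hi : W ≤ U i) (a : Γ(X, V)), X.presheaf.map (homOfLE hWV).op (E V hV a) =
        VectorField.toFun (D i) W hi (X.presheaf.map (homOfLE hWV).op a) := by
    intro V hV W hWV i hi a
    have h := congrArg (X.presheaf.map (homOfLE (le_inf hWV hi)).op) (hE V hV a i)
    rw [VectorField.res' (D i), ← CommRingCat.comp_apply, ← CommRingCat.comp_apply,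
      ← Functor.map_comp] at h
    exact h
  refine ⟨(⟨E, ?_, ?_, ?_, ?_⟩ : VectorField f (iSup U)), ?_, ?_⟩
  · intro V hV a b
    refine section_ext U V hV _ _ fun i => ?_
    rw [map_add, hE, hE, hE, map_add]
    exact VectorField.map_add' (D i) _ _ _ _
  · intro V hV a b
    refine section_ext U V hV _ _ fun i => ?_
    rw [map_add, map_mul, map_mul, hE, hE, hE, map_mul]
    exact VectorField.leibniz' (D i) _ _ _ _
  · intro V hV W h c
    refine section_ext U V hV _ _ fun i => ?_
    rw [hE, map_zero, ← CommRingCat.comp_apply, Scheme.Hom.appLE_map]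
    exact VectorField.map_base' (D i) _ _ W _ c
  · intro V hV W hWV a
    refine section_ext U W (hWV.trans hV) _ _ fun i => ?_
    rw [hE, ← CommRingCat.comp_apply, ← CommRingCat.comp_apply, ← Functor.map_comp]
    exact hE' V hV _ (inf_le_left.trans hWV) i inf_le_right a
  · intro i
    refine VectorField.ext ?_
    funext V hV a
    have h := hE' V (hV.trans (le_iSup U i)) V le_rfl i hV a
    have e : X.presheaf.map (homOfLE (le_refl V)).op = 𝟙 _ := X.presheaf.map_id _
    rw [e] at h
    exact h
  · intro E₂ hE₂
    refine VectorField.ext ?_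
    funext V hV a
    refine section_ext U V hV _ _ fun i => ?_
    have h : ∀ (W : X.Opens) (hW : W ≤ U i) (b : Γ(X, W)),
        VectorField.toFun E₂ W (hW.trans (le_iSup U i)) b = VectorField.toFun (D i) W hW b :=
      fun W hW b => congrArg (fun F : VectorField f (U i) => F.toFun W hW b) (hE₂ i)
    refine (VectorField.res' E₂ V hV _ inf_le_left a).trans ((h _ inf_le_right _).trans ?_)
    exact (hE V hV a i).symm

/-- The relative tangent sheaf `T_{X/S}` of `f : X ⟶ S`, i.e. the sheaf of derivations of `𝒪_X`
over `S`; equivalently, the dual of the sheaf of relative differentials. -/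
def tangentSheaf {X S : Scheme.{u}} (f : X ⟶ S) : X.Modules where
  val :=
    letI (U : X.Opensᵒᵖ) : Module (X.ringCatSheaf.obj.obj U) ((tangentPresheaf f).obj U) :=
      inferInstanceAs (Module Γ(X, U.unop) (VectorField f U.unop))
    PresheafOfModules.ofPresheaf (tangentPresheaf f) (by
      intro U V i r D
      refine VectorField.ext ?_
      funext W hW a
      have h : X.presheaf.map (homOfLE (hW.trans i.unop.le)).op =
          X.presheaf.map i ≫ X.presheaf.map (homOfLE hW).op := by
        rw [← Functor.map_comp]; rfl
      exact congrArg (fun φ => CommRingCat.Hom.hom φ r * VectorField.toFun D W _ a) h)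
  isSheaf := tangentPresheaf_isSheaf f

/-! ### Coherent and torsion free modules -/

/-- Coherence of a sheaf of modules on a locally noetherian scheme: it is quasi-coherent and its
sections over every affine open form a finitely generated module. -/
structure IsCoherent {X : Scheme.{u}} (M : X.Modules) : Prop where
  isQuasicoherent : M.IsQuasicoherent
  finite : ∀ U : X.affineOpens, Module.Finite Γ(X, U.1) Γ(M, U.1)

/-- A sheaf of modules is torsion free if, over affine opens, no nonzero section is killed by a
non-zero-divisor. -/
def IsTorsionFree {X : Scheme.{u}} (M : X.Modules) : Prop :=
  ∀ (U : X.affineOpens), ∀ r ∈ nonZeroDivisors Γ(X, U.1), ∀ m : Γ(M, U.1), r • m = 0 → m = 0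

/-- A submodule `i : F ⟶ M` is saturated if the quotient `M / F` is torsion free. -/
def IsSaturated {X : Scheme.{u}} {F M : X.Modules} (i : F ⟶ M) : Prop :=
  IsTorsionFree (Limits.cokernel i)

/-! ### Line bundles with a section, and cyclic covers -/

/-- A scheme is normal if its local rings are integrally closed domains. -/
def IsNormal (X : Scheme.{u}) : Prop :=
  ∀ x : X, IsDomain (X.presheaf.stalk x) ∧ IsIntegrallyClosed (X.presheaf.stalk x)

/-- A Cartier divisor on an integral scheme, given by a local equation at every point; on a
neighbourhood of `x`, the local equation at `x` differs from the local equation at each point `y`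
by a unit of `𝒪_{X,y}`. The corresponding line bundle is generated near `x` by the inverse of the
local equation, and every line bundle on an integral scheme arises in this way. -/
structure CartierDivisor (X : Scheme.{u}) [IsIntegral X] where
  eqn : X → X.functionField
  eqn_ne_zero : ∀ x, eqn x ≠ 0
  locally_eq : ∀ x, ∃ U : X.Opens, x ∈ U ∧ ∀ y ∈ U, ∃ v : (X.presheaf.stalk y)ˣ,
    eqn y = algebraMap (X.presheaf.stalk y) X.functionField v * eqn x

variable {X : Scheme.{u}} [IsIntegral X]

/-- The rational function `s` is a nonzero global section of `H^{⊗ g}` (`H` being the line bundle of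
a Cartier divisor) and its divisor of zeros is reduced: written in a local generator at `x`, i.e. as
`s * (H.eqn x) ^ g`, it is regular, and at the points of codimension one it vanishes to order at
most one. -/
structure IsReducedSection (H : CartierDivisor X) (g : ℕ) (s : X.functionField) : Prop where
  ne_zero : s ≠ 0
  regular : ∀ x : X, ∃ a : X.presheaf.stalk x,
    algebraMap (X.presheaf.stalk x) X.functionField a = s * H.eqn x ^ g
  reduced : ∀ x : X, Order.coheight x = 1 → ∀ a : X.presheaf.stalk x,
    algebraMap (X.presheaf.stalk x) X.functionField a = s * H.eqn x ^ g →
      a ∉ IsLocalRing.maximalIdeal (X.presheaf.stalk x) ^ 2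

/-- The ring of rational functions `K(X)[T] / (T ^ g - s)` of the cyclic cover of `X` obtained by
extracting a `g`-th root of the section `s` of `H^{⊗ g}`. -/
abbrev coverRing (g : ℕ) (s : X.functionField) : Type u :=
  AdjoinRoot (Polynomial.X ^ g - Polynomial.C s)

/-- The morphism to `X` from the spectrum of the ring of rational functions of the cyclic cover. -/
def coverGeneric (g : ℕ) (s : X.functionField) :
    Spec (CommRingCat.of (coverRing g s)) ⟶ X :=
  Spec.map (CommRingCat.ofHom (algebraMap X.functionField (coverRing g s))) ≫
    X.fromSpecStalk (genericPoint X)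

instance (g : ℕ) (s : X.functionField) : QuasiCompact (coverGeneric g s) := by
  have : QuasiCompact (X.fromSpecStalk (genericPoint X)) := by
    have : IsNoetherianRing (X.presheaf.stalk (genericPoint X)) :=
      inferInstanceAs (IsNoetherianRing X.functionField)
    infer_instance
  unfold coverGeneric; infer_instance

instance (g : ℕ) (s : X.functionField) : QuasiSeparated (coverGeneric g s) := by
  unfold coverGeneric; infer_instance

/-- The (normalized) cyclic cover: the normalization of the cyclic cover of degree `g` associated to
`s`, i.e. the normalization of `X` in `K(X)[T] / (T ^ g - s)`. -/
abbrev cyclicCover (g : ℕ) (s : X.functionField) : Scheme.{u} :=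
  (coverGeneric g s).normalization

/-- The projection `π : Y ⟶ X` of the cyclic cover. -/
abbrev coverMap (g : ℕ) (s : X.functionField) : cyclicCover g s ⟶ X :=
  (coverGeneric g s).fromNormalization

/-- The automorphism `T ↦ ζ T` of `K(X)[T] / (T ^ g - s)`, for a `g`-th root of unity `ζ`. -/
def rootHom (g : ℕ) (s : X.functionField) (ζ : rootsOfUnity g X.functionField) :
    coverRing g s →ₐ[X.functionField] coverRing g s :=
  AdjoinRoot.liftAlgHom _ (Algebra.ofId _ _)
    (algebraMap X.functionField (coverRing g s) (ζ : (X.functionField)ˣ) *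
      AdjoinRoot.root (Polynomial.X ^ g - Polynomial.C s)) (by
    have hζ : ((ζ : (X.functionField)ˣ) : X.functionField) ^ g = 1 := by
      have h := (mem_rootsOfUnity g (ζ : (X.functionField)ˣ)).1 ζ.2
      rw [← Units.val_pow_eq_pow_val, h, Units.val_one]
    have hr := AdjoinRoot.eval₂_root (Polynomial.X ^ g - Polynomial.C s)
    simp only [Polynomial.eval₂_sub, Polynomial.eval₂_pow, Polynomial.eval₂_X,
      Polynomial.eval₂_C] at hr ⊢
    rw [mul_pow, ← map_pow, hζ, map_one, one_mul]
    exact hr)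

lemma rootHom_coverGeneric (g : ℕ) (s : X.functionField) (ζ : rootsOfUnity g X.functionField) :
    Spec.map (CommRingCat.ofHom (rootHom g s ζ).toRingHom) ≫ coverGeneric g s =
      coverGeneric g s := by
  unfold coverGeneric
  rw [← Category.assoc, ← Spec.map_comp, ← CommRingCat.ofHom_comp]
  congr 3
  exact (rootHom g s ζ).comp_algebraMap

/-- The action of the Galois group `μ_g` (cyclic of order `g`) on the cyclic cover: `ζ` acts by the
automorphism induced by `T ↦ ζ T`. -/
def deck (g : ℕ) (s : X.functionField) (ζ : rootsOfUnity g X.functionField) :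
    cyclicCover g s ⟶ cyclicCover g s :=
  (coverGeneric g s).normalizationDesc
    (Spec.map (CommRingCat.ofHom (rootHom g s ζ).toRingHom) ≫ (coverGeneric g s).toNormalization)
    (coverGeneric g s).fromNormalization
    (by rw [Category.assoc, Scheme.Hom.toNormalization_fromNormalization, rootHom_coverGeneric])

lemma deck_coverMap (g : ℕ) (s : X.functionField) (ζ : rootsOfUnity g X.functionField) :
    deck g s ζ ≫ coverMap g s = coverMap g s :=
  Scheme.Hom.normalizationDesc_comp _ _ _ _

/-- The canonical isomorphism `σ^* π^* M ≅ π^* M` for an endomorphism `σ` of `Y` over `X`. -/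
def linearization {X Y : Scheme.{u}} {π : Y ⟶ X} {σ : Y ⟶ Y} (h : σ ≫ π = π) (M : X.Modules) :
    (Scheme.Modules.pullback σ).obj ((Scheme.Modules.pullback π).obj M) ≅
      (Scheme.Modules.pullback π).obj M :=
  (Scheme.Modules.pullbackComp σ π).app M ≪≫ (Scheme.Modules.pullbackCongr h).app M

/-- A submodule `i : F ⟶ π^* M` on the cyclic cover is invariant under the Galois group if, for
every `σ` in that group, the natural action `σ^* π^* M ≅ π^* M` identifies `σ^* F` with `F`. -/
def IsGaloisInvariant (g : ℕ) (s : X.functionField) {M : X.Modules} {F : (cyclicCover g s).Modules}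
    (i : F ⟶ (Scheme.Modules.pullback (coverMap g s)).obj M) : Prop :=
  ∀ ζ : rootsOfUnity g X.functionField,
    ∃ e : (Scheme.Modules.pullback (deck g s ζ)).obj F ≅ F,
      e.hom ≫ i = (Scheme.Modules.pullback (deck g s ζ)).map i ≫
        (linearization (deck_coverMap g s ζ) M).hom

end CyclicDescent

end

/-!
Let `π : Y ⟶ X` be the cyclic cover, `T` the tangent sheaf of `X`, and `F ≤ π^* T` coherent, invariant
and saturated. The candidate for the descended module is `descent i`, whose sections over `U` are the
vector fields on `U` whose pullback to `Y` lies in `F`.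

Locally on `X` the cover is a Kummer extension. Over an affine open `U = Spec A` on which `h` is a local
equation of `H`, the function `a = s * h ^ g` is regular, and the cover is the spectrum of the integral
closure `B` of `A` in `K[T] / (T ^ g - s)`, which contains `t = h * T` with `t ^ g = a`. Reducedness of
the divisor of `s` gives `B = ⨁ A t ^ k` for `k < g`: if `∑ c k * t ^ k` is integral, then averaging over
the Galois group shows that each `c k * t ^ k` is integral, so that `(c k) ^ g * a ^ k` lies in `A`; at a
prime of height one, `v(a) ≤ 1` and `k < g` force `v(c k) ≥ 0`, and a normal noetherian domain is the
intersection of its localizations at such primes (`mem_range_of_pow_mul_pow_mem_range`,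
`mem_range_of_isIntegral_sum`, `exists_isKummerGenerator`).

Consequently `π^* T` over `U` is the direct sum of the `t ^ k • T`, and these summands are eigenspaces of
a generator of the Galois group with eigenvalues `ω ^ k`. The invariant submodule `F` is therefore the
direct sum of its components; if `t ^ k • η` lies in `F`, with `η` pulled back from `X`, then so does `η`,
because `F` is saturated and `t` is not a zero divisor (`IsKummerGenerator.exists_app_eq`). Hence `F` is
the direct sum of the `t ^ k • descent i`, which is `π^* (descent i)`
(`IsKummerGenerator.pullbackDescent_app_bijective`).

Three facts about modules on schemes make this precise. Quasi-coherence amounts to sections localizing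
on affine opens (`isQuasicoherent_of_isLocalizingOn`), which yields that the tangent sheaf is
quasi-coherent, by clearing denominators of derivations on finitely many generators
(`isQuasicoherent_tangentSheaf`), and that `descent i` is, as a fibre product
(`isLocalizingOn_of_isPullback`). Sections of the pullback of a quasi-coherent module over affine opens are
obtained by base change (`IsPullbackMap.isSemiBaseChange`). A morphism of quasi-coherent modules which is
bijective on sections over an affine open cover is an isomorphism (`isIso_of_app_bijective`).
-/

noncomputable section

universe u

namespace CyclicDescent

/-! ### Quasi-coherence in terms of sections over affine opens -/

section
variable {X Y : Scheme.{u}}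

lemma fromSpec_image_le {U : X.Opens} (hU : IsAffineOpen U) (W : (Spec Γ(X, U)).Opens) :
    hU.fromSpec ''ᵁ W ≤ U := by
  have := hU.fromSpec.image_le_opensRange (U := W)
  rwa [hU.opensRange_fromSpec] at this

lemma appIso_fromSpec_inv {U : X.Opens} (hU : IsAffineOpen U) (W : (Spec Γ(X, U)).Opens) :
    (Scheme.ΓSpecIso Γ(X, U)).inv ≫ (Spec Γ(X, U)).presheaf.map W.leTop.op ≫
      (hU.fromSpec.appIso W).inv = X.presheaf.map (homOfLE (fromSpec_image_le hU W)).op := by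
  rw [← Category.assoc, Iso.comp_inv_eq, Scheme.Hom.appIso_hom, ← Category.assoc,
    Scheme.Hom.naturality]
  rw [hU.fromSpec_app_self]
  simp only [Category.assoc, ← Functor.map_comp]
  rfl

lemma restrict_fromSpec_smul {U : X.Opens} (hU : IsAffineOpen U) (M : X.Modules)
    (W : (Spec Γ(X, U)).Opens) (r : Γ(X, U)) (x : Γ(M.restrict hU.fromSpec, W)) :
    (M.restrictAppIso hU.fromSpec W).hom (r • x) =
      X.presheaf.map (homOfLE (fromSpec_image_le hU W)).op r •
        (M.restrictAppIso hU.fromSpec W).hom x := by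
  rw [Scheme.Modules.smul_Spec_def, ← appIso_fromSpec_inv]
  rfl

/-- The sections of `M` over the basic opens of `U` are localizations of the sections over `U`:
those over `U` which vanish on `D(f)` are killed by a power of `f`, and those over `D(f)`
extend to `U` after multiplication by a power of `f`. For an affine open `U` this expresses that `M`
is quasi-coherent on `U`. -/
structure IsLocalizingOn (M : X.Modules) (U : X.Opens) : Prop where
  exists_pow_smul_eq_zero : ∀ (f : Γ(X, U)) (s : Γ(M, U)),
    M.presheaf.map (homOfLE (X.basicOpen_le f)).op s = 0 → ∃ n : ℕ, f ^ n • s = 0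
  exists_map_eq : ∀ (f : Γ(X, U)) (t : Γ(M, X.basicOpen f)), ∃ (n : ℕ) (s : Γ(M, U)),
    M.presheaf.map (homOfLE (X.basicOpen_le f)).op s =
      X.presheaf.map (homOfLE (X.basicOpen_le f)).op (f ^ n) • t

lemma presheaf_map_map (M : X.Modules) {U V W : X.Opens} (i : op U ⟶ op V) (j : op V ⟶ op W)
    (k : op U ⟶ op W) (x : Γ(M, U)) :
    M.presheaf.map j (M.presheaf.map i x) = M.presheaf.map k x := by
  rw [← AddCommGrpCat.comp_apply, ← Functor.map_comp]
  rfl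

/-- The global sections of the restriction of `M` along `Spec Γ(X, U) ⟶ X` are the sections of `M`
over `U`. -/
def fromSpecTopIso {U : X.Opens} (hU : IsAffineOpen U) (M : X.Modules) :
    Γ(M.restrict hU.fromSpec, ⊤) ≅ Γ(M, U) :=
  M.restrictAppIso hU.fromSpec ⊤ ≪≫ M.presheaf.mapIso (eqToIso (by
    rw [Scheme.Hom.image_top_eq_opensRange, hU.opensRange_fromSpec])).op

/-- The basic open subset of a spectrum, as an open subset of the scheme. -/
abbrev specBasicOpen {R : CommRingCat.{u}} (f : R) : (Spec R).Opens := PrimeSpectrum.basicOpen f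

/-- The sections over `D(f)` of the restriction of `M` along `Spec Γ(X, U) ⟶ X` are the sections
of `M` over `D(f) ≤ U`. -/
def fromSpecBasicOpenIso {U : X.Opens} (hU : IsAffineOpen U) (M : X.Modules) (f : Γ(X, U)) :
    Γ(M.restrict hU.fromSpec, specBasicOpen f) ≅ Γ(M, X.basicOpen f) :=
  M.restrictAppIso hU.fromSpec _ ≪≫ M.presheaf.mapIso (eqToIso (by
    exact (hU.fromSpec_image_basicOpen f).symm)).op

lemma fromSpecTopIso_smul {U : X.Opens} (hU : IsAffineOpen U) (M : X.Modules) (r : Γ(X, U))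
    (x : Γ(M.restrict hU.fromSpec, ⊤)) :
    (fromSpecTopIso hU M).hom (r • x) = r • (fromSpecTopIso hU M).hom x := by
  change M.presheaf.map _ ((M.restrictAppIso hU.fromSpec ⊤).hom (r • x)) = r • M.presheaf.map _ _
  rw [restrict_fromSpec_smul]
  refine (M.map_smul _ _ _).trans ?_
  rw [← CommRingCat.comp_apply, ← Functor.map_comp]
  congr 1
  exact congr($(X.presheaf.map_id _) r)

lemma fromSpecBasicOpenIso_smul {U : X.Opens} (hU : IsAffineOpen U) (M : X.Modules) (f r : Γ(X, U))
    (x : Γ(M.restrict hU.fromSpec, specBasicOpen f)) :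
    (fromSpecBasicOpenIso hU M f).hom (r • x) = X.presheaf.map (homOfLE (X.basicOpen_le f)).op r •
      (fromSpecBasicOpenIso hU M f).hom x := by
  change M.presheaf.map _ ((M.restrictAppIso hU.fromSpec _).hom (r • x)) = _ • M.presheaf.map _ _
  rw [restrict_fromSpec_smul]
  refine (M.map_smul _ _ _).trans ?_
  rw [← CommRingCat.comp_apply, ← Functor.map_comp]
  rfl

lemma fromSpecBasicOpenIso_map {U : X.Opens} (hU : IsAffineOpen U) (M : X.Modules) (f : Γ(X, U))
    (x : Γ(M.restrict hU.fromSpec, ⊤)) :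
    (fromSpecBasicOpenIso hU M f).hom ((M.restrict hU.fromSpec).presheaf.map
      (PrimeSpectrum.basicOpen f).leTop.op x) = M.presheaf.map (homOfLE (X.basicOpen_le f)).op
      ((fromSpecTopIso hU M).hom x) := by
  change M.presheaf.map _ (M.presheaf.map _ _) = M.presheaf.map _ (M.presheaf.map _ _)
  exact (presheaf_map_map M _ _ (homOfLE ((X.basicOpen_le f).trans' le_rfl |>.trans
    (by rw [Scheme.Hom.image_top_eq_opensRange, hU.opensRange_fromSpec]))).op _).trans
    (presheaf_map_map M _ _ _ _).symm

theorem isLocalizingOn_iff {U : X.Opens} (hU : IsAffineOpen U) (M : X.Modules) :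
    IsLocalizingOn M U ↔ IsLocalizing (modulesSpecToSheaf.obj (M.restrict hU.fromSpec)) := by
  let N := M.restrict hU.fromSpec
  let φ (f : Γ(X, U)) :=
    ((modulesSpecToSheaf.obj N).obj.map (PrimeSpectrum.basicOpen f).leTop.op).hom
  have hinj (f : Γ(X, U)) : Function.Injective (fromSpecBasicOpenIso hU M f).hom :=
    ((ConcreteCategory.bijective_of_isIso _)).1
  have hinj' : Function.Injective (fromSpecTopIso hU M).hom :=
    ((ConcreteCategory.bijective_of_isIso _)).1
  have hφ (f : Γ(X, U)) (x : Γ(N, ⊤)) : (fromSpecBasicOpenIso hU M f).hom (φ f x) =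
    M.presheaf.map (homOfLE (X.basicOpen_le f)).op ((fromSpecTopIso hU M).hom x) :=
      fromSpecBasicOpenIso_map hU M f x
  refine ⟨fun h f ↦ IsLocalizedModule.Away.mk_of_addCommGroup ?_ ?_ ?_, fun h ↦ ⟨?_, ?_⟩⟩
  · exact Scheme.Modules.isUnit_algebraMap_end_of_le_basicOpen f le_rfl
  · intro t
    obtain ⟨n, s, hs⟩ := h.exists_map_eq f ((fromSpecBasicOpenIso hU M f).hom t)
    refine ⟨n, (fromSpecTopIso hU M).inv s, hinj f ?_⟩
    refine ((fromSpecBasicOpenIso_smul hU M f _ t).trans ?_).trans (hφ f _).symm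
    refine hs.symm.trans ?_
    congr 1
    exact congr($((fromSpecTopIso hU M).inv_hom_id) s).symm
  · intro s hs
    obtain ⟨n, hn⟩ := h.exists_pow_smul_eq_zero f ((fromSpecTopIso hU M).hom s) <| by
      exact (hφ f s).symm.trans ((congrArg _ hs).trans (map_zero _))
    refine ⟨n, hinj' ?_⟩
    exact (fromSpecTopIso_smul hU M _ s).trans (hn.trans (map_zero _).symm)
  · intro f s hs
    have hf : IsLocalizedModule.Away f (φ f) := h f
    have h0 : φ f ((fromSpecTopIso hU M).inv s) = 0 := by
      apply hinj f
      rw [hφ, Iso.inv_hom_id_apply]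
      exact hs.trans (map_zero _).symm
    obtain ⟨⟨_, n, rfl⟩, hn⟩ := (IsLocalizedModule.eq_zero_iff (.powers f) (φ f)).mp h0
    refine ⟨n, ?_⟩
    have := congrArg (fromSpecTopIso hU M).hom hn
    refine Eq.trans ?_ (this.trans (map_zero _))
    refine Eq.trans ?_ (fromSpecTopIso_smul hU M _ _).symm
    rw [Iso.inv_hom_id_apply]
  · intro f t
    have hf : IsLocalizedModule.Away f (φ f) := h f
    obtain ⟨n, y, hy⟩ := hf.surj _ _ ((fromSpecBasicOpenIso hU M f).inv t)
    refine ⟨n, (fromSpecTopIso hU M).hom y, ?_⟩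
    refine (hφ f y).symm.trans ?_
    rw [← hy]
    refine (fromSpecBasicOpenIso_smul hU M f _ _).trans ?_
    rw [Iso.inv_hom_id_apply]

theorem isLocalizingOn_of_isQuasicoherent {U : X.Opens} (hU : IsAffineOpen U) (M : X.Modules)
    [M.IsQuasicoherent] : IsLocalizingOn M U := by
  rw [isLocalizingOn_iff hU, ← isIso_fromTildeΓ_iff_isLocalizing]
  infer_instance

/-- Transport of a presentation along an isomorphism of modules on a scheme. -/
def presentationOfIso {M N : X.Modules} (e : M ≅ N) (P : SheafOfModules.Presentation M) :
    SheafOfModules.Presentation N := by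
  let f : @Quiver.Hom (SheafOfModules X.ringCatSheaf) _ M N := e.hom
  have : IsIso f := Iso.isIso_hom e
  exact SheafOfModules.Presentation.ofIsIso.{u, u, u} f P

/-- If the sections of `M` localize on an affine open `U`, the restriction of `M` to
`Spec Γ(X, U)` is a module `N~`; its presentation is transported along `U ≅ Spec Γ(X, U)` to the
slice site over `U`, on which quasi-coherence is tested. -/
lemma isQuasicoherent_over_of_isLocalizingOn {U : X.Opens} (hU : IsAffineOpen U) (M : X.Modules)
    (h : IsLocalizingOn M U) : (SheafOfModules.over M U).IsQuasicoherent := by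
  rw [isLocalizingOn_iff hU, ← isIso_fromTildeΓ_iff_isLocalizing] at h
  let N := M.restrict hU.fromSpec
  have hN : IsIso N.fromTildeΓ := h
  let P₁ : N.Presentation := presentationOfIso (asIso N.fromTildeΓ)
    (presentationTilde.{u} _ .univ (by simp) _ (Submodule.span_eq _))
  let P₂ := Scheme.Modules.presentationRestrict hU.isoSpec.hom P₁
  let e₁ : Scheme.Modules.restrictFunctor hU.fromSpec ⋙
      Scheme.Modules.restrictFunctor hU.isoSpec.hom ≅
      SheafOfModules.overFunctor X.ringCatSheaf U ⋙ (Scheme.Modules.overEquiv U).functor :=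
    (Scheme.Modules.restrictFunctorComp _ _).symm ≪≫
      Scheme.Modules.restrictFunctorCongr hU.isoSpec_hom_fromSpec ≪≫
      (Scheme.Modules.overFunctorEquiv U).symm
  let P₃ : SheafOfModules.Presentation ((Scheme.Modules.overEquiv U).functor.obj
      (SheafOfModules.over M U)) :=
    presentationOfIso (e₁.app M) P₂
  let eu : (Scheme.Modules.overEquiv U).functor.obj (SheafOfModules.unit (X.ringCatSheaf.over U)) ≅
      SheafOfModules.unit (U : Scheme.{u}).ringCatSheaf :=
    (Scheme.Modules.overFunctorEquiv U).app (SheafOfModules.unit X.ringCatSheaf) ≪≫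
      Scheme.Modules.restrictUnitIso U.ι
  let eu' : SheafOfModules.unit (X.ringCatSheaf.over U) ≅
      (Scheme.Modules.overEquiv U).inverse.obj (SheafOfModules.unit (U : Scheme.{u}).ringCatSheaf) :=
    (Scheme.Modules.overEquiv U).unitIso.app _ ≪≫ (Scheme.Modules.overEquiv U).inverse.mapIso eu
  have : (Scheme.Modules.overEquiv U).inverse.IsEquivalence := inferInstance
  let G : SheafOfModules (U : Scheme.{u}).ringCatSheaf ⥤ SheafOfModules (X.ringCatSheaf.over U) :=
    (Scheme.Modules.overEquiv U).inverse
  have : Limits.PreservesColimitsOfSize.{u, u} G :=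
    (Scheme.Modules.overEquiv U).symm.toAdjunction.leftAdjoint_preservesColimits
  let P₄ := P₃.map G eu'
  exact (SheafOfModules.Presentation.ofIsIso.{u, u, u}
    ((Scheme.Modules.overEquiv U).unitIso.app _).inv P₄).isQuasicoherent

/-- Quasi-coherence is a local property, and on an affine open it holds if the sections
localize. -/
theorem isQuasicoherent_of_isLocalizingOn (M : X.Modules)
    (h : ∀ x : X, ∃ U : X.Opens, x ∈ U ∧ IsAffineOpen U ∧ IsLocalizingOn M U) :
    M.IsQuasicoherent := by
  choose U hxU hU hM using h
  have (x : X) : (SheafOfModules.over M (U x)).IsQuasicoherent :=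
    isQuasicoherent_over_of_isLocalizingOn (hU x) M (hM x)
  refine SheafOfModules.IsQuasicoherent.of_coversTop M U ?_
  rw [Opens.coversTop_iff]
  exact eq_top_iff.2 fun x _ => Opens.mem_iSup.2 ⟨x, hxU x⟩

end

/-! ### The universal property of the pullback of modules -/

section
variable {X Y Z : Scheme.{u}}
open Scheme.Modules

/-- A morphism `α : M ⟶ g_* N` exhibiting `N` as the pullback `g^* M`: every morphism `M ⟶ g_* P`
factors uniquely as `α` followed by `g_*` of a morphism `N ⟶ P`. Unlike `g^* M` itself, such a pair
`(N, α)` can be restricted to open subschemes and composed without coherence isomorphisms. -/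
def IsPullbackMap (g : Y ⟶ X) {M : X.Modules} {N : Y.Modules}
    (α : M ⟶ (pushforward g).obj N) : Prop :=
  ∀ P : Y.Modules, Function.Bijective fun γ : N ⟶ P => α ≫ (pushforward g).map γ

lemma isPullbackMap_of_adjunction {g : Y ⟶ X} {L : X.Modules ⥤ Y.Modules} (adj : L ⊣ pushforward g)
    (M : X.Modules) : IsPullbackMap g (adj.unit.app M) := by
  intro P
  have : (fun γ : L.obj M ⟶ P => adj.unit.app M ≫ (pushforward g).map γ) = adj.homEquiv M P := by
    funext γ
    exact (adj.homEquiv_unit M P γ).symm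
  rw [this]
  exact (adj.homEquiv M P).bijective

lemma IsPullbackMap.comp {g : Y ⟶ X} {h : Z ⟶ Y} {M : X.Modules} {N : Y.Modules} {P : Z.Modules}
    {α : M ⟶ (pushforward g).obj N} {β : N ⟶ (pushforward h).obj P} (hα : IsPullbackMap g α)
    (hβ : IsPullbackMap h β) : IsPullbackMap (h ≫ g)
      (α ≫ (pushforward g).map β ≫ (pushforwardComp h g).hom.app P) := by
  intro Q
  have : (fun γ : P ⟶ Q => (α ≫ (pushforward g).map β ≫ (pushforwardComp h g).hom.app P) ≫
      (pushforward (h ≫ g)).map γ) =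
      (fun δ => δ ≫ (pushforwardComp h g).hom.app Q) ∘
      (fun δ => α ≫ (pushforward g).map δ) ∘ (fun γ => β ≫ (pushforward h).map γ) := by
    funext γ
    simp only [Category.assoc, Function.comp_apply, Functor.map_comp]
    congr 2
  rw [this]
  exact (Iso.homToEquiv ((pushforwardComp h g).app Q)).bijective.comp ((hα _).comp (hβ Q))

/-- If `α` and the composite of `α` and `β` exhibit pullbacks, then so does `β`. -/
lemma IsPullbackMap.of_comp {g : Y ⟶ X} {h : Z ⟶ Y} {M : X.Modules} {N : Y.Modules} {P : Z.Modules}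
    {α : M ⟶ (pushforward g).obj N} {β : N ⟶ (pushforward h).obj P} (hα : IsPullbackMap g α)
    (hβ : IsPullbackMap (h ≫ g)
      (α ≫ (pushforward g).map β ≫ (pushforwardComp h g).hom.app P)) : IsPullbackMap h β := by
  intro Q
  have : (fun γ : P ⟶ Q => (α ≫ (pushforward g).map β ≫ (pushforwardComp h g).hom.app P) ≫
      (pushforward (h ≫ g)).map γ) =
      ((fun δ => δ ≫ (pushforwardComp h g).hom.app Q) ∘
      (fun δ => α ≫ (pushforward g).map δ)) ∘ (fun γ => β ≫ (pushforward h).map γ) := by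
    funext γ
    simp only [Category.assoc, Function.comp_apply, Functor.map_comp]
    congr 2
  have h1 := hβ Q
  rw [this] at h1
  exact (Function.Bijective.of_comp_iff'
    ((Iso.homToEquiv ((pushforwardComp h g).app Q)).bijective.comp (hα _)) _).1 h1

lemma IsPullbackMap.congr {g h : Y ⟶ X} (e : g = h) {M : X.Modules} {N : Y.Modules}
    {α : M ⟶ (pushforward g).obj N} (hα : IsPullbackMap g α) :
    IsPullbackMap h (α ≫ (pushforwardCongr e).hom.app N) := by
  intro Q
  have : (fun γ : N ⟶ Q => (α ≫ (pushforwardCongr e).hom.app N) ≫ (pushforward h).map γ) =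
      (fun δ => δ ≫ (pushforwardCongr e).hom.app Q) ∘ (fun δ => α ≫ (pushforward g).map δ) := by
    funext γ
    simp only [Category.assoc, Function.comp_apply]
    congr 1
    exact ((pushforwardCongr e).hom.naturality γ).symm
  rw [this]
  exact (Iso.homToEquiv ((pushforwardCongr e).app Q)).bijective.comp (hα Q)

/-- Pullback is local: a map exhibiting a pullback along `g` induces one along the restriction
`ρ` of `g` to open subschemes. -/
lemma exists_isPullbackMap_restrict {g : Y ⟶ X} {X' Y' : Scheme.{u}} (iX : X' ⟶ X) (iY : Y' ⟶ Y)
    [IsOpenImmersion iX] [IsOpenImmersion iY] (ρ : Y' ⟶ X') (e : iY ≫ g = ρ ≫ iX)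
    {M : X.Modules} {N : Y.Modules} {α : M ⟶ (pushforward g).obj N} (hα : IsPullbackMap g α) :
    ∃ β : M.restrict iX ⟶ (pushforward ρ).obj (N.restrict iY), IsPullbackMap ρ β ∧
      (restrictAdjunction iX).unit.app M ≫ (pushforward iX).map β ≫
        (pushforwardComp ρ iX).hom.app _ =
      (α ≫ (pushforward g).map ((restrictAdjunction iY).unit.app N) ≫
        (pushforwardComp iY g).hom.app _) ≫ (pushforwardCongr e).hom.app _ := by
  have h1 := isPullbackMap_of_adjunction (restrictAdjunction iX) M
  have h2 := (hα.comp (isPullbackMap_of_adjunction (restrictAdjunction iY) N)).congr e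
  obtain ⟨β, hβ⟩ := (h1 ((pushforward ρ).obj (N.restrict iY))).2
    (((α ≫ (pushforward g).map ((restrictAdjunction iY).unit.app N) ≫
        (pushforwardComp iY g).hom.app _) ≫ (pushforwardCongr e).hom.app _) ≫
        (pushforwardComp ρ iX).inv.app _)
  have h3 : (restrictAdjunction iX).unit.app M ≫ (pushforward iX).map β ≫
        (pushforwardComp ρ iX).hom.app _ =
      (α ≫ (pushforward g).map ((restrictAdjunction iY).unit.app N) ≫
        (pushforwardComp iY g).hom.app _) ≫ (pushforwardCongr e).hom.app _ := by
    have := congr($hβ ≫ (pushforwardComp ρ iX).hom.app _)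
    simpa only [Category.assoc, Iso.inv_hom_id_app, Category.comp_id] using this
  refine ⟨β, h1.of_comp ?_, h3⟩
  rw [h3]
  exact h2

/-- A morphism from a quasi-coherent module on `Spec R` is the same as a linear map on
global sections, by the adjunction between `~` and global sections. -/
lemma existsUnique_hom_of_isQuasicoherent {R : CommRingCat.{u}} (M Q : (Spec R).Modules)
    [M.IsQuasicoherent] (u : Γ(M, ⊤) →ₗ[R] Γ(Q, ⊤)) :
    ∃! γ : M ⟶ Q, ∀ x, γ.app ⊤ x = u x := by
  have hb : Function.Bijective fun γ : M ⟶ Q => moduleSpecΓFunctor.map γ := by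
    have h1 : (fun γ : M ⟶ Q => moduleSpecΓFunctor.map γ) =
        (tilde.adjunction (R := R)).homEquiv _ _ ∘ (fun γ : M ⟶ Q => M.fromTildeΓ ≫ γ) := by
      funext γ
      refine Eq.symm (((tilde.adjunction (R := R)).homEquiv_unit _ _ _).trans ?_)
      refine (congrArg _ (moduleSpecΓFunctor.map_comp _ _)).trans ?_
      exact (tilde.adjunction (R := R)).right_triangle_components_assoc M _
    rw [h1]
    have := Scheme.Modules.isIso_fromTildeΓ_of_isQuasicoherent M
    exact (Equiv.bijective _).comp (asIso M.fromTildeΓ).symm.homFromEquiv.bijective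
  let u' : moduleSpecΓFunctor.obj M ⟶ moduleSpecΓFunctor.obj Q :=
    ModuleCat.ofHom (X := Γ(M, ⊤)) (Y := Γ(Q, ⊤)) u
  obtain ⟨γ, hγ⟩ := hb.2 u'
  refine ⟨γ, fun x => congr($hγ x), fun γ' h => hb.1 ?_⟩
  refine Eq.trans ?_ hγ.symm
  ext x
  exact h x

lemma pushforward_smul {R S : CommRingCat.{u}} (φ : R ⟶ S) (Q : (Spec S).Modules) (r : R)
    (x : Γ((pushforward (Spec.map φ)).obj Q, ⊤)) :
    (r • x : Γ((pushforward (Spec.map φ)).obj Q, ⊤)) = (φ r • (show Γ(Q, ⊤) from x) : Γ(Q, ⊤)) := by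
  rw [smul_Spec_def, smul_Spec_def]
  have h1 : (Spec.map φ).app ⊤ ((Spec R).presheaf.map (Opens.leTop ⊤).op ((Scheme.ΓSpecIso R).inv r)) =
      (Spec S).presheaf.map (Opens.leTop ⊤).op ((Scheme.ΓSpecIso S).inv (φ r)) := by
    have e1 : (Spec R).presheaf.map (Opens.leTop ⊤).op = 𝟙 _ := (Spec R).presheaf.map_id _
    have e2 : (Spec S).presheaf.map (Opens.leTop ⊤).op = 𝟙 _ := (Spec S).presheaf.map_id _
    rw [e1, e2]
    exact congr($(Scheme.ΓSpecIso_inv_naturality φ) r).symm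
  exact congrArg (fun a : Γ(Spec S, ⊤) => (a • (show Γ(Q, ⊤) from x) : Γ(Q, ⊤))) h1

lemma isQuasicoherent_of_iso {M N : X.Modules} (e : M ≅ N) [M.IsQuasicoherent] :
    N.IsQuasicoherent :=
  (SheafOfModules.isQuasicoherent X.ringCatSheaf).prop_of_iso
    (X := M) (Y := N) e inferInstance

lemma IsPullbackMap.exists_iso {g : Y ⟶ X} {M : X.Modules} {N : Y.Modules}
    {α : M ⟶ (pushforward g).obj N} (hα : IsPullbackMap g α) :
    Nonempty ((Scheme.Modules.pullback g).obj M ≅ N) := by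
  have h := isPullbackMap_of_adjunction (pullbackPushforwardAdjunction g) M
  obtain ⟨u, hu⟩ := (h N).2 α
  obtain ⟨v, hv⟩ := (hα _).2 ((pullbackPushforwardAdjunction g).unit.app M)
  dsimp only at hu hv
  refine ⟨⟨u, v, (h _).1 ?_, (hα _).1 ?_⟩⟩
  · dsimp only
    rw [Functor.map_comp, ← Category.assoc, hu, hv]
    exact ((congrArg _ ((pushforward g).map_id _)).trans (Category.comp_id _)).symm
  · dsimp only
    rw [Functor.map_comp, ← Category.assoc, hv, hu]
    exact ((congrArg _ ((pushforward g).map_id _)).trans (Category.comp_id _)).symm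

lemma final_opens_map (g : Y ⟶ X) : (Opens.map g.base).Final :=
  Functor.final_of_exists_of_isFiltered _ (fun _ => ⟨⊤, ⟨homOfLE le_top⟩⟩)
    fun {_ c} _ _ => ⟨c, 𝟙 _, Subsingleton.elim _ _⟩

/-- The structure morphism `𝒪_X ⟶ g_* 𝒪_Y` as a morphism of modules. -/
def unitToPushforwardUnit (g : Y ⟶ X) : (show X.Modules from SheafOfModules.unit X.ringCatSheaf) ⟶
    (pushforward g).obj (show Y.Modules from SheafOfModules.unit Y.ringCatSheaf) :=
  SheafOfModules.unitToPushforwardObjUnit g.toRingCatSheafHom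

lemma isPullbackMap_unitToPushforwardUnit (g : Y ⟶ X) :
    IsPullbackMap g (unitToPushforwardUnit g) := by
  intro P
  have := final_opens_map g
  let e₁ := SheafOfModules.unitHomEquiv (show SheafOfModules Y.ringCatSheaf from P)
  let e₂ := SheafOfModules.unitHomEquiv
    ((SheafOfModules.pushforward g.toRingCatSheafHom).obj (show SheafOfModules Y.ringCatSheaf from P))
  have h : (fun γ => unitToPushforwardUnit g ≫ (pushforward g).map γ) =
      e₂.symm ∘ SheafOfModules.pushforwardSections g.toRingCatSheafHom
        (M := (show SheafOfModules Y.ringCatSheaf from P)) ∘ e₁ := by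
    funext γ
    refine e₂.injective ?_
    refine Eq.trans ?_ (e₂.apply_symm_apply _).symm
    exact (SheafOfModules.pushforwardSections_unitHomEquiv g.toRingCatSheafHom γ).symm
  rw [h]
  exact e₂.symm.bijective.comp ((SheafOfModules.bijective_pushforwardSections
    g.toRingCatSheafHom (show SheafOfModules Y.ringCatSheaf from P)).comp e₁.bijective)

/-- The pullback functor preserves colimits and the structure sheaf, hence presentations. -/
lemma isQuasicoherent_pullback_Spec {R S : CommRingCat.{u}} (φ : R ⟶ S) (M : (Spec R).Modules)
    [M.IsQuasicoherent] : ((Scheme.Modules.pullback (Spec.map φ)).obj M).IsQuasicoherent := by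
  have := Scheme.Modules.isIso_fromTildeΓ_of_isQuasicoherent M
  let P₁ : SheafOfModules.Presentation M := presentationOfIso (asIso M.fromTildeΓ)
    (presentationTilde.{u} _ .univ (by simp) _ (Submodule.span_eq _))
  let G : SheafOfModules (Spec R).ringCatSheaf ⥤ SheafOfModules (Spec S).ringCatSheaf :=
    Scheme.Modules.pullback (Spec.map φ)
  have : G.IsLeftAdjoint := (pullbackPushforwardAdjunction (Spec.map φ)).isLeftAdjoint
  have : Limits.PreservesColimitsOfSize.{u, u} G :=
    (pullbackPushforwardAdjunction (Spec.map φ)).leftAdjoint_preservesColimits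
  let e : SheafOfModules.unit (Spec S).ringCatSheaf ≅ G.obj (SheafOfModules.unit _) :=
    (isPullbackMap_unitToPushforwardUnit (Spec.map φ)).exists_iso.some.symm
  exact (P₁.map G e).isQuasicoherent

end

/-! ### Sections of the pullback of a quasi-coherent module -/

section
variable {X Y Z : Scheme.{u}}
open Scheme.Modules

/-- `fromSpecTopIso` as a linear equivalence over `Γ(X, U)`. -/
def fromSpecTopEquiv {U : X.Opens} (hU : IsAffineOpen U) (M : X.Modules) :
    Γ(M.restrict hU.fromSpec, ⊤) ≃ₗ[Γ(X, U)] Γ(M, U) :=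
  { (fromSpecTopIso hU M).addCommGroupIsoToAddEquiv with
    map_smul' := fromSpecTopIso_smul hU M }

lemma fromSpecTopEquiv_eq {U : X.Opens} (hU : IsAffineOpen U) (M : X.Modules)
    (W : (Spec Γ(X, U)).Opens) (hW : U ≤ hU.fromSpec ''ᵁ W) (x : Γ(M.restrict hU.fromSpec, ⊤)) :
    fromSpecTopEquiv hU M x = M.presheaf.map (homOfLE hW).op
      ((M.restrict hU.fromSpec).presheaf.map (homOfLE le_top).op x) :=
  (presheaf_map_map M (U := hU.fromSpec ''ᵁ ⊤) (V := hU.fromSpec ''ᵁ W) _ _ _ _).symm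

lemma map_fromSpecTopEquiv {U : X.Opens} (hU : IsAffineOpen U) (M : X.Modules)
    (W : (Spec Γ(X, U)).Opens) (hW : hU.fromSpec ''ᵁ W ≤ U) (x : Γ(M.restrict hU.fromSpec, ⊤)) :
    M.presheaf.map (homOfLE hW).op (fromSpecTopEquiv hU M x) =
      (M.restrict hU.fromSpec).presheaf.map (homOfLE le_top).op x :=
  presheaf_map_map M (U := hU.fromSpec ''ᵁ ⊤) _ _ _ _

/-- The map `Γ(M, U) → Γ(N, V)` induced by `α : M ⟶ g_* N` for `V ≤ g⁻¹ U`; it is semilinear over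
`Γ(X, U) → Γ(Y, V)`. -/
def sectionMap {g : Y ⟶ X} {M : X.Modules} {N : Y.Modules} (α : M ⟶ (pushforward g).obj N)
    {U : X.Opens} {V : Y.Opens} (h : V ≤ g ⁻¹ᵁ U) : Γ(M, U) →ₛₗ[(g.appLE U V h).hom] Γ(N, V) where
  toFun m := N.presheaf.map (homOfLE h).op (show Γ(N, g ⁻¹ᵁ U) from α.app U m)
  map_add' a b := by
    rw [map_add]
    exact map_add (N.presheaf.map (homOfLE h).op).hom _ _
  map_smul' r m := by
    rw [Hom.app_smul]
    exact Scheme.Modules.map_smul N (homOfLE h) (g.app U r) _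

lemma sectionMap_apply {g : Y ⟶ X} {M : X.Modules} {N : Y.Modules} (α : M ⟶ (pushforward g).obj N)
    {U : X.Opens} {V : Y.Opens} (h : V ≤ g ⁻¹ᵁ U) (m : Γ(M, U)) :
    sectionMap α h m = N.presheaf.map (homOfLE h).op (show Γ(N, g ⁻¹ᵁ U) from α.app U m) := rfl

/-- A `σ`-semilinear map `v : M → N` exhibiting `N` as the base change `B ⊗[A] M`, expressed by the
universal property so that no `A`-module structure on `N` has to be chosen. -/
def IsSemiBaseChange {A B : Type u} [CommRing A] [CommRing B] {σ : A →+* B} {M N : Type u}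
    [AddCommGroup M] [AddCommGroup N] [Module A M] [Module B N] (v : M →ₛₗ[σ] N) : Prop :=
  ∀ (E : Type u) [AddCommGroup E] [Module B E] (w : M →ₛₗ[σ] E), ∃! l : N →ₗ[B] E, l.comp v = w

/-- The linear map on global sections induced by a morphism of modules on `Spec R`. -/
def topLinearMap {R : CommRingCat.{u}} {M Q : (Spec R).Modules} (γ : M ⟶ Q) :
    Γ(M, ⊤) →ₗ[R] Γ(Q, ⊤) := (moduleSpecΓFunctor.map γ).hom

lemma isSemiBaseChange_Spec {R S : CommRingCat.{u}} (φ : R ⟶ S) {M : (Spec R).Modules}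
    {N : (Spec S).Modules} [M.IsQuasicoherent] [N.IsQuasicoherent]
    {β : M ⟶ (pushforward (Spec.map φ)).obj N} (hβ : IsPullbackMap (Spec.map φ) β)
    (v : Γ(M, ⊤) →ₛₗ[φ.hom] Γ(N, ⊤)) (hv : ∀ x, v x = β.app ⊤ x) : IsSemiBaseChange v := by
  intro E _ _ w
  let Q : (Spec S).Modules := tilde (ModuleCat.of S E)
  let i : E ≃ₗ[S] Γ(Q, ⊤) := (tilde.isoTop (ModuleCat.of S E)).toLinearEquiv
  let w' : Γ(M, ⊤) →ₗ[R] Γ((pushforward (Spec.map φ)).obj Q, ⊤) :=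
    { toFun := fun x => i (w x)
      map_add' := fun x y => by rw [map_add, map_add]; rfl
      map_smul' := fun r x => by
        refine (congrArg i (w.map_smulₛₗ r x)).trans ((i.map_smul _ _).trans ?_)
        exact (pushforward_smul φ Q r _).symm }
  obtain ⟨δ, hδ, hδ'⟩ := existsUnique_hom_of_isQuasicoherent M _ w'
  obtain ⟨γ, hγ⟩ := (hβ Q).2 δ
  have hγ' (x : Γ(M, ⊤)) : γ.app ⊤ (v x) = i (w x) := by
    rw [hv]
    exact (congr(Hom.app $hγ ⊤ x)).trans (hδ x)
  refine ⟨i.symm.toLinearMap.comp (topLinearMap γ), ?_, fun l hl => ?_⟩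
  · ext x
    exact i.symm_apply_eq.2 (hγ' x)
  · obtain ⟨γ', h1, -⟩ := existsUnique_hom_of_isQuasicoherent N Q (i.toLinearMap.comp l)
    have h2 : γ' = γ := by
      refine (hβ Q).1 (Eq.trans (hδ' _ fun x => ?_) hγ.symm)
      refine Eq.trans ?_ ((h1 (v x)).trans congr(i ($hl x)))
      rw [hv]
      rfl
    ext x
    refine i.injective ((h1 x).symm.trans ?_)
    rw [h2]
    exact (i.apply_symm_apply _).symm

lemma sectionMap_fromSpecTopEquiv {g : Y ⟶ X} {M : X.Modules} {N : Y.Modules}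
  {α : M ⟶ (pushforward g).obj N} {U : X.Opens} {V : Y.Opens} (hU : IsAffineOpen U)
  (hV : IsAffineOpen V) (h : V ≤ g ⁻¹ᵁ U)
  (e : hV.fromSpec ≫ g = Spec.map (g.appLE U V h) ≫ hU.fromSpec)
  {β : M.restrict hU.fromSpec ⟶
    (pushforward (Spec.map (g.appLE U V h))).obj (N.restrict hV.fromSpec)}
  (hαβ : (restrictAdjunction hU.fromSpec).unit.app M ≫ (pushforward hU.fromSpec).map β ≫
      (pushforwardComp (Spec.map (g.appLE U V h)) hU.fromSpec).hom.app _ =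
    (α ≫ (pushforward g).map ((restrictAdjunction hV.fromSpec).unit.app N) ≫
      (pushforwardComp hV.fromSpec g).hom.app _) ≫ (pushforwardCongr e).hom.app _)
  (x : Γ(M.restrict hU.fromSpec, ⊤)) :
  fromSpecTopEquiv hV N (β.app ⊤ x) = sectionMap α h (fromSpecTopEquiv hU M x) := by
  have hle' : hV.fromSpec ''ᵁ (Spec.map (g.appLE U V h) ⁻¹ᵁ (hU.fromSpec ⁻¹ᵁ U)) ≤ g ⁻¹ᵁ U := by
    rw [← Scheme.Hom.comp_preimage, ← e, Scheme.Hom.comp_preimage]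
    exact hV.fromSpec.image_preimage_le (g ⁻¹ᵁ U)
  have h1 : β.app (hU.fromSpec ⁻¹ᵁ U) (M.presheaf.map
        (homOfLE (hU.fromSpec.image_preimage_le U)).op (fromSpecTopEquiv hU M x)) =
      N.presheaf.map (homOfLE hle').op (show Γ(N, g ⁻¹ᵁ U) from α.app U (fromSpecTopEquiv hU M x)) :=
    congr(Hom.app $hαβ U (fromSpecTopEquiv hU M x)).trans (presheaf_map_map N _ _ _ _)
  have h2 : M.presheaf.map (homOfLE (hU.fromSpec.image_preimage_le U)).op (fromSpecTopEquiv hU M x) =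
      (M.restrict hU.fromSpec).presheaf.map (homOfLE le_top).op x := map_fromSpecTopEquiv hU M _ _ x
  have h3 : β.app (hU.fromSpec ⁻¹ᵁ U) ((M.restrict hU.fromSpec).presheaf.map (homOfLE le_top).op x) =
      ((pushforward (Spec.map (g.appLE U V h))).obj (N.restrict hV.fromSpec)).presheaf.map
        (homOfLE le_top).op (β.app ⊤ x) :=
    congr($(β.mapPresheaf.naturality (homOfLE le_top).op) x)
  rw [h2, h3] at h1
  have hle : V ≤ hV.fromSpec ''ᵁ (Spec.map (g.appLE U V h) ⁻¹ᵁ (hU.fromSpec ⁻¹ᵁ U)) := by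
    rw [← Scheme.Hom.comp_preimage, ← e, Scheme.Hom.comp_preimage,
      Scheme.Hom.image_preimage_eq_opensRange_inf, hV.opensRange_fromSpec]
    exact le_inf le_rfl h
  have h4 := congrArg (N.presheaf.map (homOfLE hle).op) h1
  rw [presheaf_map_map N _ _ (homOfLE h).op] at h4
  rw [sectionMap_apply]
  refine (fromSpecTopEquiv_eq hV N (Spec.map (g.appLE U V h) ⁻¹ᵁ (hU.fromSpec ⁻¹ᵁ U)) hle
    (β.app ⊤ x)).trans h4

/-- If `N` is the pullback of a quasi-coherent `M` along `g`, and `U`, `V` are affine opens with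
`V ≤ g⁻¹ U`, then `Γ(N, V)` is the base change of `Γ(M, U)`. Both sides are restricted to spectra,
where a quasi-coherent module is the same as its global sections. -/
lemma IsPullbackMap.isSemiBaseChange {g : Y ⟶ X} {M : X.Modules} {N : Y.Modules}
    [M.IsQuasicoherent] {α : M ⟶ (pushforward g).obj N} (hα : IsPullbackMap g α) {U : X.Opens} {V : Y.Opens} (hU : IsAffineOpen U)
    (hV : IsAffineOpen V) (h : V ≤ g ⁻¹ᵁ U) :
    IsSemiBaseChange (sectionMap α h) ∧ (N.restrict hV.fromSpec).IsQuasicoherent := by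
  have e : hV.fromSpec ≫ g = Spec.map (g.appLE U V h) ≫ hU.fromSpec :=
    (IsAffineOpen.SpecMap_appLE_fromSpec g hU hV h).symm
  obtain ⟨β, hβ, hαβ⟩ := exists_isPullbackMap_restrict hU.fromSpec hV.fromSpec _ e hα
  have hN : (N.restrict hV.fromSpec).IsQuasicoherent :=
    have := isQuasicoherent_pullback_Spec (g.appLE U V h) (M.restrict hU.fromSpec)
    isQuasicoherent_of_iso hβ.exists_iso.some
  refine ⟨?_, hN⟩
  let eU := fromSpecTopEquiv hU M
  let eV := fromSpecTopEquiv hV N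
  have key (x : Γ(M.restrict hU.fromSpec, ⊤)) : eV (β.app ⊤ x) = sectionMap α h (eU x) :=
    sectionMap_fromSpecTopEquiv hU hV h e hαβ x
  let v : Γ(M.restrict hU.fromSpec, ⊤) →ₛₗ[(g.appLE U V h).hom] Γ(N.restrict hV.fromSpec, ⊤) :=
    (eV.symm.toLinearMap.comp (sectionMap α h)).comp eU.toLinearMap
  have hv (x) : v x = β.app ⊤ x := eV.symm_apply_eq.2 (key x).symm
  have hb := isSemiBaseChange_Spec (g.appLE U V h) hβ v hv
  intro E _ _ w
  obtain ⟨l, hl, hl'⟩ := hb E (w.comp eU.toLinearMap)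
  refine ⟨l.comp eV.symm.toLinearMap, ?_, fun l' h' => ?_⟩
  · ext m
    have := congr($hl (eU.symm m))
    simpa [v] using this
  · have := hl' (l'.comp eV.toLinearMap) (by
      ext x
      simpa [v] using congr($h' (eU x)))
    ext n
    simpa using congr($this (eV.symm n))

theorem IsPullbackMap.isQuasicoherent {g : Y ⟶ X} {M : X.Modules} {N : Y.Modules}
    [M.IsQuasicoherent] {α : M ⟶ (pushforward g).obj N} (hα : IsPullbackMap g α) :
    N.IsQuasicoherent := by
  refine isQuasicoherent_of_isLocalizingOn N fun y => ?_
  obtain ⟨_, ⟨U, hU, rfl⟩, hyU, -⟩ := X.isBasis_affineOpens.exists_subset_of_mem_open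
    (Set.mem_univ (g y)) isOpen_univ
  obtain ⟨_, ⟨V, hV, rfl⟩, hyV, hVU⟩ := Y.isBasis_affineOpens.exists_subset_of_mem_open
    (show y ∈ g ⁻¹ᵁ U from hyU) (g ⁻¹ᵁ U).2
  have := (hα.isSemiBaseChange hU hV hVU).2
  refine ⟨V, hyV, hV, ?_⟩
  rw [isLocalizingOn_iff hV, ← isIso_fromTildeΓ_iff_isLocalizing]
  exact Scheme.Modules.isIso_fromTildeΓ_of_isQuasicoherent _

/-- If `B` is free over `A` with basis `t`, a base change to `B` is the direct sum of the
`t i • M`. -/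
theorem IsSemiBaseChange.bijective_sum {A B : Type u} [CommRing A] [CommRing B] {σ : A →+* B}
    {M N : Type u} [AddCommGroup M] [AddCommGroup N] [Module A M] [Module B N] {v : M →ₛₗ[σ] N}
    (hv : IsSemiBaseChange v) {n : ℕ} (t : Fin n → B)
    (ht : Function.Bijective fun c : Fin n → A => ∑ i, σ (c i) * t i) :
    Function.Bijective fun m : Fin n → M => ∑ i, t i • v (m i) := by
  let : Algebra A B := σ.toAlgebra
  let : Module A N := Module.compHom N σ
  have : IsScalarTower A B N := ⟨fun a b x => mul_smul (σ a) b x⟩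
  let v' : M →ₗ[A] N := { v with map_smul' := fun a m => v.map_smulₛₗ a m }
  have hb : IsBaseChange B v' := by
    refine IsBaseChange.of_lift_unique v' fun Q _ _ _ _ w => ?_
    let : AddCommGroup Q := Module.addCommMonoidToAddCommGroup A
    let w' : M →ₛₗ[σ] Q := { w with
      map_smul' := fun a m => (w.map_smul a m).trans (by
        rw [← IsScalarTower.algebraMap_smul B]; rfl) }
    obtain ⟨l, hl, hl'⟩ := hv Q w'
    refine ⟨l, LinearMap.ext fun m => congr($hl m), fun l' h' => hl' l' ?_⟩
    exact LinearMap.ext fun m => congr($h' m)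
  let e : (Fin n → A) ≃ₗ[A] B := LinearEquiv.ofBijective
    { toFun := fun c => ∑ i, σ (c i) * t i
      map_add' := fun c d => by simp [add_mul, Finset.sum_add_distrib]
      map_smul' := fun a c => by
        simp only [Pi.smul_apply, smul_eq_mul, map_mul, RingHom.id_apply, mul_assoc,
          ← Finset.mul_sum]
        rfl } ht
  let b : Module.Basis (Fin n) A B := Module.Basis.ofEquivFun e.symm
  have hbt (i : Fin n) : b i = t i := by
    simp [b, e, Module.Basis.coe_ofEquivFun, Pi.single_apply, apply_ite σ]
  let E : (Fin n → M) ≃ N :=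
    (Finsupp.equivFunOnFinite.symm.trans (TensorProduct.equivFinsuppOfBasisLeft b).symm.toEquiv).trans
      hb.equiv.toEquiv
  convert E.bijective using 1
  funext m
  simp [E, TensorProduct.equivFinsuppOfBasisLeft_symm_apply, Finsupp.sum_fintype, hbt,
    IsBaseChange.equiv_tmul]
  rfl

end

/-! ### Sections of kernels, fibre products and isomorphisms -/

section
variable {X Y Z : Scheme.{u}}
open Scheme.Modules
open scoped ZeroObject

/-- The functor of sections over `U`, with values in abelian groups. -/
def sectionsFunctor (U : X.Opens) : X.Modules ⥤ Ab.{u} :=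
  toPresheaf X ⋙ (evaluation _ _).obj (op U)

instance (U : X.Opens) :
    Limits.PreservesLimitsOfShape Limits.WalkingCospan (sectionsFunctor U) :=
  have := Limits.evaluation_preservesLimitsOfShape (J := Limits.WalkingCospan) (C := Ab.{u}) (op U)
  Limits.comp_preservesLimitsOfShape _ _

lemma app_injective {F M : X.Modules} (i : F ⟶ M) [Mono i] (U : X.Opens) :
    Function.Injective (i.app U) :=
  (AddCommGrpCat.mono_iff_injective _).1 (inferInstanceAs (Mono ((sectionsFunctor U).map i)))

lemma exists_app_eq_of_isPullback {F G H P : X.Modules} {p : P ⟶ F} {q : P ⟶ G} {a : F ⟶ H}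
    {b : G ⟶ H} (h : IsPullback p q a b) (U : X.Opens) (x : Γ(F, U)) (y : Γ(G, U))
    (e : a.app U x = b.app U y) : ∃ z : Γ(P, U), p.app U z = x ∧ q.app U z = y := by
  have h1 : IsPullback (p.app U) (q.app U) (a.app U) (b.app U) := h.map (sectionsFunctor U)
  have h2 := h1.map (forget Ab)
  obtain ⟨z, h3, h4⟩ := (Limits.Types.exists_of_isPullback h2 x y e)
  exact ⟨z, h3, h4⟩

/-- Left exactness of sections: a section of `M` which vanishes in the quotient `M / F` is a section
of `F`. -/
lemma exists_app_eq_of_cokernel_eq_zero {F M : X.Modules} (i : F ⟶ M) [Mono i] (U : X.Opens)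
    (m : Γ(M, U)) (hm : (Limits.cokernel.π i).app U m = 0) : ∃ y : Γ(F, U), i.app U y = m := by
  have h : IsPullback i (0 : F ⟶ (0 : X.Modules)) (Limits.cokernel.π i)
      (0 : (0 : X.Modules) ⟶ _) := by
    refine ⟨⟨by simp⟩, ⟨Limits.PullbackCone.IsLimit.mk _ (fun s => Abelian.monoLift i s.fst (by
      rw [s.condition, Limits.comp_zero])) (fun s => Abelian.monoLift_comp _ _ _)
      (fun s => (Limits.isZero_zero _).eq_of_tgt _ _) fun s m h1 h2 => ?_⟩⟩
    rw [← cancel_mono i, h1, Abelian.monoLift_comp]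
  obtain ⟨z, hz, -⟩ := exists_app_eq_of_isPullback h U m 0 (by rw [hm, map_zero])
  exact ⟨z, hz⟩

lemma app_map (M N : X.Modules) (φ : M ⟶ N) {U V : X.Opens} (h : V ≤ U) (x : Γ(M, U)) :
    φ.app V (M.presheaf.map (homOfLE h).op x) = N.presheaf.map (homOfLE h).op (φ.app U x) :=
  congr($(φ.mapPresheaf.naturality (homOfLE h).op) x)

lemma isUnit_map_basicOpen {U : X.Opens} (f : Γ(X, U)) (n : ℕ) :
    IsUnit (X.presheaf.map (homOfLE (X.basicOpen_le f)).op (f ^ n)) := by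
  rw [map_pow]
  exact (RingedSpace.isUnit_res_basicOpen _ f).pow n

lemma IsLocalizingOn.app_bijective {M N : X.Modules} (φ : M ⟶ N) {U : X.Opens}
    (hM : IsLocalizingOn M U) (hN : IsLocalizingOn N U) (h : Function.Bijective (φ.app U))
    (f : Γ(X, U)) : Function.Bijective (φ.app (X.basicOpen f)) := by
  constructor
  · rw [injective_iff_map_eq_zero]
    intro t ht
    obtain ⟨n, s, hs⟩ := hM.exists_map_eq f t
    obtain ⟨k, hk⟩ := hN.exists_pow_smul_eq_zero f (φ.app U s) (by
      rw [← app_map, hs, Hom.app_smul, ht, smul_zero])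
    have h0 : f ^ k • s = 0 := h.1 (by rw [Hom.app_smul, hk, map_zero])
    have h1 := congrArg (M.presheaf.map (homOfLE (X.basicOpen_le f)).op) h0
    rw [Scheme.Modules.map_smul, hs, smul_smul, map_zero] at h1
    exact ((isUnit_map_basicOpen f k).mul (isUnit_map_basicOpen f n)).smul_eq_zero.1 h1
  · intro t
    obtain ⟨n, s, hs⟩ := hN.exists_map_eq f t
    obtain ⟨r, rfl⟩ := h.2 s
    obtain ⟨v, hv⟩ := isUnit_map_basicOpen f n
    refine ⟨(↑v⁻¹ : Γ(X, X.basicOpen f)) • M.presheaf.map (homOfLE (X.basicOpen_le f)).op r, ?_⟩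
    rw [Hom.app_smul, app_map, hs, ← hv, smul_smul, Units.inv_mul, one_smul]

/-- A morphism of quasi-coherent modules which is bijective on sections over the members of
an affine open cover is an isomorphism: it is then bijective over the basic opens of the members,
which form a basis of the topology. -/
theorem isIso_of_app_bijective {M N : X.Modules} (φ : M ⟶ N) [M.IsQuasicoherent]
    [N.IsQuasicoherent] (h : ∀ x : X, ∃ U : X.Opens, x ∈ U ∧ IsAffineOpen U ∧
      Function.Bijective (φ.app U)) : IsIso φ := by
  let ι := {W : X.Opens // Function.Bijective (φ.app W)}
  have hB : Opens.IsBasis (Set.range (Subtype.val : ι → X.Opens)) := by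
    rw [Opens.isBasis_iff_nbhd]
    intro W x hx
    obtain ⟨U, hxU, hU, hb⟩ := h x
    obtain ⟨f, hf, hxf⟩ := hU.exists_basicOpen_le ⟨x, hx⟩ hxU
    exact ⟨X.basicOpen f, ⟨⟨_, (isLocalizingOn_of_isQuasicoherent hU M).app_bijective φ
      (isLocalizingOn_of_isQuasicoherent hU N) hb f⟩, rfl⟩, hxf, hf⟩
  have h1 : IsIso (⟨φ.mapPresheaf⟩ : (⟨M.presheaf, M.isSheaf⟩ : TopCat.Sheaf Ab X) ⟶
      ⟨N.presheaf, N.isSheaf⟩) :=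
    TopCat.Sheaf.isIso_iff_isIso_basis hB fun W =>
      (ConcreteCategory.isIso_iff_bijective (φ.app W.1)).2 W.2
  have h2 : IsIso ((toPresheaf X).map φ) := (TopCat.Sheaf.forget Ab X).map_isIso
    (⟨φ.mapPresheaf⟩ : (⟨M.presheaf, M.isSheaf⟩ : TopCat.Sheaf Ab X) ⟶ ⟨N.presheaf, N.isSheaf⟩)
  exact isIso_of_reflects_iso φ (toPresheaf X)

end

/-! ### Quasi-coherence of the tangent sheaf -/

section
variable {X S : Scheme.{u}}

lemma res_res {U V W : X.Opens} (h : W ≤ V) (h' : V ≤ U) (a : Γ(X, U)) :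
    X.presheaf.map (homOfLE h).op (X.presheaf.map (homOfLE h').op a) =
      X.presheaf.map (homOfLE (h.trans h')).op a := by
  rw [← CommRingCat.comp_apply, ← Functor.map_comp]
  rfl

/-- On an integral scheme a function is determined by its restriction to a nonempty open `O`. -/
lemma res_inf_injective [IsIntegral X] {O : X.Opens} (hO : O ≠ ⊥) (V : X.Opens) :
    Function.Injective (X.presheaf.map (homOfLE (inf_le_left : V ⊓ O ≤ V)).op) := by
  by_cases hV : V = ⊥
  · subst hV
    exact fun a b _ => Subsingleton.elim _ _
  · have : Nonempty (V ⊓ O : X.Opens) := by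
      have h1 := nonempty_preirreducible_inter V.2 O.2 (Opens.ne_bot_iff_nonempty _ |>.1 hV)
        (Opens.ne_bot_iff_nonempty _ |>.1 hO)
      obtain ⟨x, hx⟩ := h1
      exact ⟨⟨x, hx⟩⟩
    exact map_injective_of_isIntegral X (homOfLE (inf_le_left : V ⊓ O ≤ V))

/-- A function on `V ⊓ O` extends to `V` as soon as it does so locally on `V`, since extensions
across the nonempty open `O` are unique. -/
lemma exists_section_of_locally [IsIntegral X] {O : X.Opens} (hO : O ≠ ⊥) (V : X.Opens)
    (c : Γ(X, V ⊓ O)) (h : ∀ x ∈ V, ∃ (W : X.Opens) (hW : W ≤ V) (b : Γ(X, W)), x ∈ W ∧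
      X.presheaf.map (homOfLE (inf_le_left : W ⊓ O ≤ W)).op b =
        X.presheaf.map (homOfLE (inf_le_inf_right O hW)).op c) :
    ∃ b : Γ(X, V), X.presheaf.map (homOfLE (inf_le_left : V ⊓ O ≤ V)).op b = c := by
  choose W hW b hxW hb using fun x : V => h x.1 x.2
  have hcov : V ≤ iSup W := fun x hx => Opens.mem_iSup.2 ⟨⟨x, hx⟩, hxW ⟨x, hx⟩⟩
  obtain ⟨s, hs, -⟩ := X.sheaf.existsUnique_gluing' W V (fun i => homOfLE (hW i)) hcov b (by
    intro i j
    apply res_inf_injective hO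
    refine (res_res _ _ _).trans (Eq.trans ?_ (res_res _ _ _).symm)
    have h1 := congrArg (X.presheaf.map (homOfLE (inf_le_inf_right O (inf_le_left : W i ⊓ W j ≤ W i))).op) (hb i)
    have h2 := congrArg (X.presheaf.map (homOfLE (inf_le_inf_right O (inf_le_right : W i ⊓ W j ≤ W j))).op) (hb j)
    rw [res_res, res_res] at h1 h2
    exact h1.trans h2.symm)
  refine ⟨s, ?_⟩
  refine X.sheaf.eq_of_locally_eq' (fun i => W i ⊓ O) (V ⊓ O)
    (fun i => homOfLE (inf_le_inf_right O (hW i))) (by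
      rw [← iSup_inf_eq]; exact inf_le_inf_right O hcov) _ _ fun i => ?_
  refine (res_res _ _ _).trans (Eq.trans ?_ (hb i))
  rw [← show X.presheaf.map (homOfLE (hW i)).op s = b i from hs i]
  exact (res_res (V := W i) _ _ _).symm

lemma vectorField_ext_of_restrict_eq_zero [IsIntegral X] {f : X ⟶ S} {U : X.Opens} {O : X.Opens}
    (hO : O ≠ ⊥) (hOU : O ≤ U) (D : VectorField f U) (hD : VectorField.restrict hOU D = 0) :
    D = 0 := by
  ext V hV a
  apply res_inf_injective hO
  rw [D.res']
  exact congrArg (fun E : VectorField f O => E.toFun (V ⊓ O) inf_le_right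
    (X.presheaf.map (homOfLE inf_le_left).op a)) hD |>.trans (map_zero _).symm

/-- A vector field on a nonempty open `O ≤ U` extends to `U` if it maps functions on opens `V ≤ U` to
functions that extend to `V`. -/
lemma exists_vectorField_extension [IsIntegral X] {f : X ⟶ S} {U O : X.Opens} (hO : O ≠ ⊥)
    (hOU : O ≤ U) (E : VectorField f O)
    (h : ∀ (V : X.Opens) (_ : V ≤ U) (a : Γ(X, V)), ∃ b : Γ(X, V),
      X.presheaf.map (homOfLE (inf_le_left : V ⊓ O ≤ V)).op b =
        E.toFun (V ⊓ O) inf_le_right (X.presheaf.map (homOfLE inf_le_left).op a)) :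
    ∃ D : VectorField f U, VectorField.restrict hOU D = E := by
  choose D hD using h
  refine ⟨⟨D, ?_, ?_, ?_, ?_⟩, ?_⟩
  · intro V hV a b
    apply res_inf_injective hO
    rw [map_add, hD, hD, hD, map_add, E.map_add']
  · intro V hV a b
    apply res_inf_injective hO
    rw [map_add, map_mul, map_mul, hD, hD, hD, map_mul, E.leibniz']
  · intro V hV W hVW c
    apply res_inf_injective hO
    rw [hD, map_zero, ← CommRingCat.comp_apply, Scheme.Hom.appLE_map]
    exact E.map_base' _ _ W _ c
  · intro V hV W hWV a
    apply res_inf_injective hO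
    rw [hD, res_res, res_res]
    have h1 := congrArg (X.presheaf.map (homOfLE (inf_le_inf_right O hWV)).op) (hD V hV a)
    rw [E.res', res_res, res_res] at h1
    exact h1
  · ext V hV a
    apply res_inf_injective hO
    rw [E.res']
    exact hD V _ a

lemma exists_res_eq_pow_mul {U : X.Opens} (hU : IsAffineOpen U) (h : Γ(X, U))
    (c : Γ(X, X.basicOpen h)) : ∃ (n : ℕ) (b : Γ(X, U)),
      X.presheaf.map (homOfLE (X.basicOpen_le h)).op b =
        X.presheaf.map (homOfLE (X.basicOpen_le h)).op (h ^ n) * c := by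
  have hloc := hU.isLocalization_basicOpen h
  obtain ⟨n, b, hb⟩ := IsLocalization.Away.surj h c
  refine ⟨n, b, ?_⟩
  rw [map_pow, mul_comm]
  exact hb.symm

/-- The denominators of a vector field `E` on `D(h)` are bounded: `h ^ n` times `E` preserves
regularity on `U`, for a single `n`. It suffices to bound the denominators on the finitely many
generators of the algebra `Γ(X, U)`. -/
lemma VectorField.exists_pow_mul_eq {f : X ⟶ S} [LocallyOfFiniteType f] [IsAffine S]
    {U : X.Opens} (hU : IsAffineOpen U) (h : Γ(X, U)) (E : VectorField f (X.basicOpen h)) :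
    ∃ n : ℕ, ∀ a : Γ(X, U), ∃ b : Γ(X, U), X.presheaf.map (homOfLE (X.basicOpen_le h)).op b =
      X.presheaf.map (homOfLE (X.basicOpen_le h)).op (h ^ n) *
        E.toFun _ le_rfl (X.presheaf.map (homOfLE (X.basicOpen_le h)).op a) := by
  have hle (W : X.Opens) : W ≤ f ⁻¹ᵁ ⊤ := fun _ _ => trivial
  have hft : (f.appLE ⊤ U (hle U)).hom.FiniteType :=
    f.finiteType_appLE (isAffineOpen_top S) hU _
  let : Algebra Γ(S, ⊤) Γ(X, U) := (f.appLE ⊤ U (hle U)).hom.toAlgebra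
  obtain ⟨G, hG⟩ : (⊤ : Subalgebra Γ(S, ⊤) Γ(X, U)).FG := hft.out
  let ρ := (X.presheaf.map (homOfLE (X.basicOpen_le h)).op).hom
  choose N B hB using fun a : Γ(X, U) => exists_res_eq_pow_mul hU h (E.toFun _ le_rfl (ρ a))
  refine ⟨G.sup N, fun a => ?_⟩
  set n := G.sup N
  have ha : a ∈ Algebra.adjoin Γ(S, ⊤) (G : Set Γ(X, U)) := by rw [hG]; trivial
  change ∃ b, ρ b = ρ (h ^ n) * E.toFun _ le_rfl (ρ a)
  induction ha using Algebra.adjoin_induction with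
  | mem x hx =>
    refine ⟨h ^ (n - N x) * B x, ?_⟩
    rw [map_mul, show ρ (B x) = _ from hB x, ← mul_assoc, ← map_mul, ← pow_add,
      Nat.sub_add_cancel (Finset.le_sup (f := N) hx)]
  | algebraMap r =>
    refine ⟨0, ?_⟩
    have h1 : ρ (algebraMap _ _ r) = (f.appLE ⊤ (X.basicOpen h) (hle _)).hom r := by
      change ((f.appLE ⊤ U (hle U)) ≫ X.presheaf.map (homOfLE (X.basicOpen_le h)).op) r = _
      rw [Scheme.Hom.appLE_map]
    rw [h1, E.map_base', map_zero, mul_zero]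
  | add x y _ _ hx hy =>
    obtain ⟨b, hb⟩ := hx
    obtain ⟨c, hc⟩ := hy
    exact ⟨b + c, by rw [map_add, map_add, E.map_add', hb, hc, mul_add]⟩
  | mul x y _ _ hx hy =>
    obtain ⟨b, hb⟩ := hx
    obtain ⟨c, hc⟩ := hy
    exact ⟨x * c + y * b, by rw [map_mul, map_add, E.leibniz', map_mul, map_mul, hb, hc]; ring⟩

/-- A vector field on a nonempty `D(h)` extends to the affine open `U` after multiplication by a
power of `h`. On a smaller basic open `D(q)` a function is a quotient `p / q ^ k` of functions on
`U`, and its derivative is `q ^ (-k) * (p' - (p / q ^ k) * (q ^ k)')`. -/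
lemma VectorField.exists_extension_pow_smul [IsIntegral X] {f : X ⟶ S} [LocallyOfFiniteType f]
    [IsAffine S] {U : X.Opens} (hU : IsAffineOpen U) (h : Γ(X, U)) (hO : X.basicOpen h ≠ ⊥)
    (E : VectorField f (X.basicOpen h)) : ∃ (n : ℕ) (D : VectorField f U),
      VectorField.restrict (X.basicOpen_le h) D =
        X.presheaf.map (homOfLE (X.basicOpen_le h)).op (h ^ n) • E := by
  obtain ⟨n, hn⟩ := E.exists_pow_mul_eq hU h
  refine ⟨n, exists_vectorField_extension hO _ _ fun V hV a => ?_⟩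
  refine exists_section_of_locally hO V _ fun x hx => ?_
  obtain ⟨q, hqV, hxq⟩ := hU.exists_basicOpen_le ⟨x, hx⟩ (hV hx)
  obtain ⟨k, p, hpq⟩ := exists_res_eq_pow_mul hU q (X.presheaf.map (homOfLE hqV).op a)
  obtain ⟨bp, hbp⟩ := hn p
  obtain ⟨bq, hbq⟩ := hn (q ^ k)
  obtain ⟨v, hv⟩ := isUnit_map_basicOpen q k
  refine ⟨X.basicOpen q, hqV, (↑v⁻¹ : Γ(X, X.basicOpen q)) *
    (X.presheaf.map (homOfLE (X.basicOpen_le q)).op bp - X.presheaf.map (homOfLE hqV).op a *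
      X.presheaf.map (homOfLE (X.basicOpen_le q)).op bq), hxq, ?_⟩
  have hWh : X.basicOpen q ⊓ X.basicOpen h ≤ X.basicOpen h := inf_le_right
  have hWq : X.basicOpen q ⊓ X.basicOpen h ≤ X.basicOpen q := inf_le_left
  have h1 := congrArg (X.presheaf.map (homOfLE hWh).op) hbp
  have h2 := congrArg (X.presheaf.map (homOfLE hWh).op) hbq
  have h3 := congrArg (X.presheaf.map (homOfLE hWq).op) hpq
  have h4 : X.presheaf.map (homOfLE hWq).op (↑v⁻¹ : Γ(X, X.basicOpen q)) *
      X.presheaf.map (homOfLE hWq).op (X.presheaf.map (homOfLE (X.basicOpen_le q)).op (q ^ k)) =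
        1 := by
    rw [← hv, ← map_mul, Units.inv_mul, map_one]
  rw [map_mul, E.res', res_res, res_res, res_res] at h1 h2
  rw [map_mul, res_res, res_res, res_res] at h3
  rw [res_res] at h4
  rw [h3, E.leibniz'] at h1
  rw [VectorField.smul_toFun, map_mul, map_sub, map_mul, map_mul, E.res', res_res, res_res, res_res,
    res_res, res_res, res_res, h1, h2]
  linear_combination (X.presheaf.map (homOfLE (hWh.trans (X.basicOpen_le h))).op (h ^ n) *
    E.toFun (X.basicOpen q ⊓ X.basicOpen h) hWh
      (X.presheaf.map (homOfLE (hWq.trans hqV)).op a)) * h4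

theorem isLocalizingOn_tangentSheaf [IsIntegral X] (f : X ⟶ S) [LocallyOfFiniteType f]
    [IsAffine S] {U : X.Opens} (hU : IsAffineOpen U) : IsLocalizingOn (tangentSheaf f) U := by
  refine ⟨fun h D hD => ?_, fun h E => ?_⟩
  · by_cases hO : X.basicOpen h = ⊥
    · refine ⟨1, ?_⟩
      rw [(basicOpen_eq_bot_iff h).1 hO, pow_one, zero_smul]
    · exact ⟨0, by
        rw [pow_zero, one_smul]
        exact vectorField_ext_of_restrict_eq_zero hO (X.basicOpen_le h) D hD⟩
  · by_cases hO : X.basicOpen h = ⊥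
    · refine ⟨0, 0, ?_⟩
      have : Subsingleton Γ(X, X.basicOpen h) := by rw [hO]; infer_instance
      have : Subsingleton Γ(tangentSheaf f, X.basicOpen h) := Module.subsingleton Γ(X, X.basicOpen h) _
      exact Subsingleton.elim _ _
    · obtain ⟨n, D, hD⟩ := VectorField.exists_extension_pow_smul hU h hO E
      exact ⟨n, D, hD⟩

theorem isQuasicoherent_of_forall_isLocalizingOn (M : X.Modules)
    (h : ∀ U : X.Opens, IsAffineOpen U → IsLocalizingOn M U) : M.IsQuasicoherent := by
  refine isQuasicoherent_of_isLocalizingOn M fun x => ?_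
  obtain ⟨_, ⟨U, hU, rfl⟩, hxU, -⟩ := X.isBasis_affineOpens.exists_subset_of_mem_open
    (Set.mem_univ x) isOpen_univ
  exact ⟨U, hxU, hU, h U hU⟩

theorem isQuasicoherent_tangentSheaf [IsIntegral X] (f : X ⟶ S) [LocallyOfFiniteType f]
    [IsAffine S] : (tangentSheaf f).IsQuasicoherent :=
  isQuasicoherent_of_forall_isLocalizingOn _ fun _ hU => isLocalizingOn_tangentSheaf f hU

end

/-! ### The natural action on a pulled back module -/

section
open Scheme.Modules
variable {X Y : Scheme.{u}}

/-- The canonical map `M ⟶ π_* π^* M`. -/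
abbrev pullbackUnit (π : Y ⟶ X) (M : X.Modules) :
    M ⟶ (pushforward π).obj ((Scheme.Modules.pullback π).obj M) :=
  (pullbackPushforwardAdjunction π).unit.app M

lemma pullbackUnit_congr {a b : Y ⟶ X} (h : a = b) (M : X.Modules) :
    pullbackUnit a M ≫ (pushforward a).map ((pullbackCongr h).hom.app M) =
      pullbackUnit b M ≫ (pushforwardCongr h).inv.app _ := by
  subst h
  have h1 : (pullbackCongr (rfl : a = a)).hom.app M = 𝟙 _ := by simp [pullbackCongr]
  have h2 : (pushforwardCongr (rfl : a = a)).inv.app ((Scheme.Modules.pullback a).obj M) = 𝟙 _ := by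
    ext U x
    exact congr($(((Scheme.Modules.pullback a).obj M).presheaf.map_id _) x)
  rw [h1, h2]
  exact congrArg _ ((pushforward a).map_id _)

lemma pullbackUnit_comp {Z : Scheme.{u}} (σ : Z ⟶ Y) (π : Y ⟶ X) (M : X.Modules) :
    pullbackUnit π M ≫ (pushforward π).map (pullbackUnit σ _) ≫ (pushforwardComp σ π).hom.app _ =
      pullbackUnit (σ ≫ π) M ≫ (pushforward (σ ≫ π)).map ((pullbackComp σ π).inv.app M) := by
  have h := unit_conjugateEquiv ((pullbackPushforwardAdjunction π).comp (pullbackPushforwardAdjunction σ))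
      (pullbackPushforwardAdjunction (σ ≫ π)) (pullbackComp σ π).inv M
  rw [conjugateEquiv_pullbackComp_inv] at h
  rw [← h]
  rfl

/-- The natural action of an endomorphism `σ` of `Y` over `X` on `π^* M`, as a morphism
`π^* M ⟶ σ_* π^* M`. It is the adjoint form of the isomorphism `σ^* π^* M ≅ π^* M`, so that it is
`σ`-semilinear on the sections over a `σ`-stable open. -/
def galoisMap {π : Y ⟶ X} {σ : Y ⟶ Y} (h : σ ≫ π = π) (M : X.Modules) :
    (Scheme.Modules.pullback π).obj M ⟶ (pushforward σ).obj ((Scheme.Modules.pullback π).obj M) :=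
  pullbackUnit σ _ ≫ (pushforward σ).map (linearization h M).hom

/-- The natural action of `σ` fixes the sections pulled back from `X`; the two sides differ by the
identification of `π_* σ_*` with `π_*`. -/
lemma pullbackUnit_galoisMap {π : Y ⟶ X} {σ : Y ⟶ Y} (h : σ ≫ π = π) (M : X.Modules) :
    pullbackUnit π M ≫ (pushforward π).map (galoisMap h M) ≫ (pushforwardComp σ π).hom.app _ =
      pullbackUnit π M ≫ (pushforwardCongr h).inv.app _ := by
  rw [← pullbackUnit_congr h]
  have h1 := congr($(pullbackUnit_comp σ π M) ≫ (pushforward (σ ≫ π)).map ((pullbackComp σ π).hom.app M ≫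
    (pullbackCongr h).hom.app M))
  have h2 : (pushforward (σ ≫ π)).map ((pullbackComp σ π).inv.app M) ≫
      (pushforward (σ ≫ π)).map ((pullbackComp σ π).hom.app M ≫ (pullbackCongr h).hom.app M) =
      (pushforward (σ ≫ π)).map ((pullbackCongr h).hom.app M) := by
    rw [← Functor.map_comp, Iso.inv_hom_id_app_assoc]
  have h3 := h1.trans ((Category.assoc _ _ _).trans (congrArg (pullbackUnit (σ ≫ π) M ≫ ·) h2))
  refine Eq.trans ?_ h3
  rw [galoisMap, Functor.map_comp]
  simp only [Category.assoc]
  rfl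

lemma galoisMap_pullbackUnit_app {π : Y ⟶ X} {σ : Y ⟶ Y} (h : σ ≫ π = π) (M : X.Modules)
    {U : X.Opens} (hle : π ⁻¹ᵁ U ≤ σ ⁻¹ᵁ (π ⁻¹ᵁ U)) (m : Γ(M, U)) :
    sectionMap (galoisMap h M) hle (sectionMap (pullbackUnit π M) le_rfl m) =
      sectionMap (pullbackUnit π M) le_rfl m := by
  let N := (Scheme.Modules.pullback π).obj M
  have e (x : Γ(N, π ⁻¹ᵁ U)) : N.presheaf.map (homOfLE (le_refl (π ⁻¹ᵁ U))).op x = x :=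
    congr($(N.presheaf.map_id _) x)
  have h1 := congr(N.presheaf.map (homOfLE hle).op $(congr(Hom.app $(pullbackUnit_galoisMap h M) U m)))
  rw [sectionMap_apply, sectionMap_apply]
  refine (congrArg (fun x => N.presheaf.map (homOfLE hle).op ((galoisMap h M).app (π ⁻¹ᵁ U) x))
    (e _)).trans (h1.trans ?_)
  exact presheaf_map_map N _ _ _ _

/-- If `σ^* F` maps into `F` under the linearization, then sections of `F` are stable under the
action of `σ`. -/
lemma exists_galoisMap_app_eq {π : Y ⟶ X} {σ : Y ⟶ Y} (h : σ ≫ π = π) {M : X.Modules}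
    {F : Y.Modules} {i : F ⟶ (Scheme.Modules.pullback π).obj M}
    (e : (Scheme.Modules.pullback σ).obj F ⟶ F)
    (he : e ≫ i = (Scheme.Modules.pullback σ).map i ≫ (linearization h M).hom)
    {V : Y.Opens} (hle : V ≤ σ ⁻¹ᵁ V) (y : Γ(F, V)) :
    ∃ y' : Γ(F, V), i.app V y' = sectionMap (galoisMap h M) hle (i.app V y) := by
  have h1 : i ≫ galoisMap h M = pullbackUnit σ F ≫ (pushforward σ).map (e ≫ i) := by
    rw [he, Functor.map_comp, galoisMap]
    exact ((pullbackPushforwardAdjunction σ).unit.naturality_assoc i _)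
  refine ⟨sectionMap (pullbackUnit σ F ≫ (pushforward σ).map e) hle y, ?_⟩
  have h2 := congr(Hom.app $h1 V y)
  rw [sectionMap_apply, sectionMap_apply, app_map]
  exact congrArg _ h2.symm

end

/-! ### Integral closure in a Kummer extension -/

/-- A noetherian integrally closed local domain is a discrete valuation ring if some element `c` of
its fraction field is not regular but multiplies the maximal ideal into the ring. As `c` is not
integral, it does not map the maximal ideal into itself, so `c⁻¹` is a uniformizer up to a unit. -/
lemma isDiscreteValuationRing_of_smul_maximalIdeal {R K : Type*} [CommRing R] [IsDomain R]
    [IsNoetherianRing R] [IsLocalRing R] [IsIntegrallyClosed R] [Field K] [Algebra R K]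
    [IsFractionRing R K] {c : K} (hc : c ∉ (algebraMap R K).range)
    (h : ∀ z ∈ IsLocalRing.maximalIdeal R, algebraMap R K z * c ∈ (algebraMap R K).range) :
    IsDiscreteValuationRing R := by
  have hinj := IsFractionRing.injective R K
  have hR : ¬ IsField R := by
    intro hf
    obtain ⟨r, hr⟩ := (IsLocalization.exist_integer_multiples_of_finset
      (nonZeroDivisors R) ({c} : Finset K))
    obtain ⟨x, hx⟩ := hr c (by simp)
    obtain ⟨y, hy⟩ := hf.mul_inv_cancel (nonZeroDivisors.ne_zero r.2)
    refine hc ⟨y * x, ?_⟩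
    rw [map_mul, hx, Algebra.smul_def, ← mul_assoc, ← map_mul, mul_comm y, hy, map_one, one_mul]
  refine ((IsDiscreteValuationRing.TFAE R hR).out 0 4).2 ?_
  let N : Submodule R K := Submodule.map (Algebra.linearMap R K) (IsLocalRing.maximalIdeal R)
  by_cases hN : ∀ y ∈ N, c * y ∈ N
  · refine absurd (IsIntegrallyClosed.algebraMap_eq_of_integral
      (isIntegral_of_smul_mem_submodule N ?_ ?_ c hN)) hc
    · obtain ⟨z, hz, hz0⟩ := Submodule.exists_mem_ne_zero_of_ne_bot
        (IsLocalRing.isField_iff_maximalIdeal_eq.not.1 hR)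
      exact (Submodule.ne_bot_iff _).2 ⟨_, ⟨z, hz, rfl⟩, (map_ne_zero_iff _ hinj).2 hz0⟩
    · exact (IsNoetherian.noetherian _).map _
  · push Not at hN
    obtain ⟨_, ⟨y, hy, rfl⟩, hy'⟩ := hN
    obtain ⟨w, hw⟩ := h y hy
    have hwu : IsUnit w := by
      by_contra hw'
      exact hy' ⟨w, hw', by rw [mul_comm]; exact hw⟩
    obtain ⟨u, rfl⟩ := hwu
    refine ⟨⟨y, le_antisymm (fun z hz => ?_) ?_⟩⟩
    · obtain ⟨k, hk⟩ := h z hz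
      refine Ideal.mem_span_singleton'.2 ⟨↑u⁻¹ * k, hinj ?_⟩
      rw [map_mul, map_mul, hk]
      calc _ = algebraMap R K ↑u⁻¹ * algebraMap R K z * (algebraMap R K y * c) := by ring
        _ = algebraMap R K (↑u⁻¹ * u) * algebraMap R K z := by rw [← hw, map_mul]; ring
        _ = _ := by rw [Units.inv_mul, map_one, one_mul]
    · rwa [Submodule.span_le, Set.singleton_subset_iff]

/-- In a discrete valuation ring with valuation `v`, if `v(a) ≤ 1` and `g * v(c) + i * v(a) ≥ 0` with
`i < g`, then `v(c) ≥ 0`. -/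
lemma mem_range_of_pow_mul_pow_mem_range_of_isDiscreteValuationRing {R K : Type*} [CommRing R]
    [IsDomain R] [IsDiscreteValuationRing R] [Field K] [Algebra R K] [IsFractionRing R K] {a : R}
    (ha : a ∉ IsLocalRing.maximalIdeal R ^ 2) {g i : ℕ} (hi : i < g) {c : K}
    (hc : c ^ g * algebraMap R K a ^ i ∈ (algebraMap R K).range) :
    c ∈ (algebraMap R K).range := by
  have hinj := IsFractionRing.injective R K
  obtain h | ⟨d, hd⟩ := ValuationRing.isInteger_or_isInteger R c
  · exact h
  by_contra hcR
  have hc0 : c ≠ 0 := by rintro rfl; exact hcR (zero_mem _)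
  have hdu : ¬ IsUnit d := by
    rintro ⟨u, rfl⟩
    refine hcR ⟨↑u⁻¹, ?_⟩
    rw [← inv_inv c, ← hd]
    refine eq_inv_of_mul_eq_one_left ?_
    rw [← map_mul, Units.inv_mul, map_one]
  obtain ⟨b, hb⟩ := hc
  have hab : a ^ i = b * d ^ g := hinj (by
    rw [map_mul, map_pow, map_pow, hb, hd, inv_pow]; field_simp)
  obtain ⟨y, hy⟩ := IsDiscreteValuationRing.exists_irreducible R
  have hm := (IsDiscreteValuationRing.irreducible_iff_uniformizer y).1 hy
  have ha0 : a ≠ 0 := by rintro rfl; exact ha (zero_mem _)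
  obtain ⟨k, u, rfl⟩ := IsDiscreteValuationRing.eq_unit_mul_pow_irreducible ha0 hy
  have hk : k ≤ 1 := by
    by_contra hk
    refine ha ?_
    rw [hm, Ideal.span_singleton_pow, Ideal.mem_span_singleton]
    exact (pow_dvd_pow y (by lia)).mul_left _
  have hyd : y ∣ d := by
    have : d ∈ IsLocalRing.maximalIdeal R := hdu
    rwa [hm, Ideal.mem_span_singleton] at this
  have h1 : y ^ g ∣ (u * y ^ k) ^ i := hab ▸ (pow_dvd_pow_of_dvd hyd g).mul_left b
  rw [mul_pow, ← pow_mul, ← Units.val_pow_eq_pow_val, Units.dvd_mul_left] at h1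
  have := (pow_dvd_pow_iff hy.ne_zero hy.not_isUnit).1 h1
  have : k * i ≤ 1 * i := Nat.mul_le_mul_right i hk
  lia

/-- Let `A` be a noetherian integrally closed domain and let `a` vanish to order at most one along
every prime of height one (expressed without localizing: no multiple `r * a` with `r ∉ p` lies in
`p ^ 2`). If `c ^ g * a ^ i` is in `A` for some `i < g`, then `c` is in `A`. Otherwise some multiple
`c'` of `c` modulo `A` has a prime annihilator `p`, and `A_p` is a discrete valuation ring in which
`c` would be regular. -/
lemma mem_range_of_pow_mul_pow_mem_range {A K : Type*} [CommRing A] [IsDomain A]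
    [IsNoetherianRing A] [IsIntegrallyClosed A] [Field K] [Algebra A K] [IsFractionRing A K]
    {a : A} (ha : ∀ p : Ideal A, p.IsPrime → p.height = 1 → ∀ r ∉ p, r * a ∉ p ^ 2)
    {g i : ℕ} (hi : i < g) {c : K} (hc : c ^ g * algebraMap A K a ^ i ∈ (algebraMap A K).range) :
    c ∈ (algebraMap A K).range := by
  by_contra hcA
  let N : Submodule A K := LinearMap.range (Algebra.linearMap A K)
  have hmem (x : K) : x ∈ N ↔ x ∈ (algebraMap A K).range := Iff.rfl
  obtain ⟨p, hp, hle⟩ := exists_le_isAssociatedPrime_of_isNoetherianRing A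
    (M := K ⧸ N) (N.mkQ c) (by simpa [hmem] using hcA)
  -- `p` is the annihilator of `c'` modulo `A`.
  obtain ⟨hp, c', hc'⟩ := isAssociatedPrime_iff.1 hp
  obtain ⟨c', rfl⟩ := N.mkQ_surjective c'
  have hcolon (r : A) (x : K) : r ∈ (⊥ : Submodule A (K ⧸ N)).colon {N.mkQ x} ↔
      algebraMap A K r * x ∈ (algebraMap A K).range := by
    rw [Submodule.mem_colon_singleton, ← map_smul, Submodule.mem_bot, Submodule.mkQ_apply,
      Submodule.Quotient.mk_eq_zero, hmem, Algebra.smul_def]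
  let R := Localization.AtPrime p
  let _ : Algebra R K := (IsLocalization.lift (M := p.primeCompl) (S := R) (g := algebraMap A K) (by
    intro y
    exact ((map_ne_zero_iff _ (IsFractionRing.injective A K)).2
      (fun h => y.2 (by rw [h]; exact zero_mem p))).isUnit)).toAlgebra
  have : IsScalarTower A R K := .of_algebraMap_eq fun x => (IsLocalization.lift_eq _ x).symm
  have hRK : IsFractionRing R K :=
    IsFractionRing.isFractionRing_of_isDomain_of_isLocalization p.primeCompl R K
  have : IsDomain R := IsLocalization.isDomain_localization p.primeCompl_le_nonZeroDivisors
  have : IsIntegrallyClosed R := isIntegrallyClosed_of_isLocalization _ p.primeCompl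
    p.primeCompl_le_nonZeroDivisors
  -- An element of `K` which is regular at `p` has a denominator outside `p`.
  have hrange (x : K) : x ∈ (algebraMap R K).range →
      ∃ r ∉ p, algebraMap A K r * x ∈ (algebraMap A K).range := by
    rintro ⟨y, rfl⟩
    obtain ⟨⟨n, r⟩, h⟩ := IsLocalization.surj p.primeCompl y
    refine ⟨r, r.2, n, ?_⟩
    rw [IsScalarTower.algebraMap_apply A R K, IsScalarTower.algebraMap_apply A R K, ← map_mul, ← h,
      mul_comm]
  have hAR {x : K} : x ∈ (algebraMap A K).range → x ∈ (algebraMap R K).range := by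
    rintro ⟨y, rfl⟩; exact ⟨algebraMap A R y, (IsScalarTower.algebraMap_apply A R K y).symm⟩
  have hdvr : IsDiscreteValuationRing R := by
    refine isDiscreteValuationRing_of_smul_maximalIdeal (K := K) (c := c') (fun h => ?_) ?_
    · obtain ⟨r, hr, h⟩ := hrange _ h
      exact hr (hc' ▸ (hcolon r c').2 h)
    · intro z hz
      rw [← Localization.AtPrime.map_eq_maximalIdeal] at hz
      have : Ideal.map (algebraMap A R) p ≤
          Submodule.comap (LinearMap.mulRight R c' ∘ₗ Algebra.linearMap R K)
            (LinearMap.range (Algebra.linearMap R K)) := by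
        rw [Ideal.map_le_iff_le_comap]
        intro r hr
        rw [hc'] at hr
        have := hAR ((hcolon r c').1 hr)
        rw [IsScalarTower.algebraMap_apply A R K] at this
        exact this
      exact this hz
  have hht : p.height = 1 := by
    have h1 := IsLocalization.AtPrime.ringKrullDim_eq_height p R
    rw [IsDiscreteValuationRing.ringKrullDim_eq_one] at h1
    exact_mod_cast h1.symm
  have ha' : algebraMap A R a ∉ IsLocalRing.maximalIdeal R ^ 2 := by
    rw [← Localization.AtPrime.map_eq_maximalIdeal, ← Ideal.map_pow,
      IsLocalization.algebraMap_mem_map_algebraMap_iff p.primeCompl]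
    rintro ⟨r, hr, h⟩
    exact ha p hp hht r hr h
  have hcR : c ∈ (algebraMap R K).range :=
    mem_range_of_pow_mul_pow_mem_range_of_isDiscreteValuationRing ha' hi (by
      rw [← IsScalarTower.algebraMap_apply A R K]
      exact hAR hc)
  obtain ⟨r, hr, h⟩ := hrange c hcR
  exact hr (hle ((hcolon r c).2 h))

/-- A submodule stable under `Φ` contains the summands of a sum of eigenvectors of `Φ`, if the
eigenvalues differ by units: `Φ - c a` kills the summand of index `a` and rescales the others by
units. -/
lemma mem_of_sum_mem_of_eigenvectors {ι R M : Type*} [CommRing R] [AddCommGroup M] [Module R M]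
    (N : Submodule R M) (Φ : M →+ M) (hN : ∀ m ∈ N, Φ m ∈ N) (c : ι → R)
    (hc : ∀ i j, i ≠ j → IsUnit (c i - c j)) (hΦ : ∀ i m, Φ (c i • m) = c i • Φ m) (T : Finset ι) :
    ∀ x : ι → M, (∀ i, Φ (x i) = c i • x i) → ∑ i ∈ T, x i ∈ N → ∀ i ∈ T, x i ∈ N := by
  classical
  induction T using Finset.induction_on with
  | empty => simp
  | insert a T ha ih =>
    intro x hx hsum
    have key : ∀ i ∈ T, x i ∈ N := by
      intro i hi
      have h1 : ∑ j ∈ T, (c j - c a) • x j ∈ N := by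
        have h2 := N.sub_mem (hN _ hsum) (N.smul_mem (c a) hsum)
        rw [map_sum, Finset.smul_sum, ← Finset.sum_sub_distrib, Finset.sum_insert ha, hx, sub_self,
          zero_add] at h2
        convert h2 using 2 with j
        rw [hx, sub_smul]
      have h3 := ih (fun j => (c j - c a) • x j) (fun j => by
        rw [sub_smul, map_sub, hΦ, hΦ, hx, smul_sub, smul_comm (c a)]) h1 i hi
      have hia : i ≠ a := by rintro rfl; exact ha hi
      exact (Submodule.smul_mem_iff_of_isUnit N (hc i a hia)).1 h3
    intro i hi
    rw [Finset.sum_insert ha] at hsum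
    rcases Finset.mem_insert.1 hi with rfl | hi
    · exact (N.add_mem_iff_left (N.sum_mem key)).1 hsum
    · exact key i hi

lemma isUnit_pow_sub_pow {k A : Type*} [Field k] [CommRing A] [Algebra k A] {ω : k} {g : ℕ}
    (hω : IsPrimitiveRoot ω g) {i j : Fin g} (hij : i ≠ j) :
    IsUnit (algebraMap k A ω ^ (i : ℕ) - algebraMap k A ω ^ (j : ℕ)) := by
  rw [← map_pow, ← map_pow, ← map_sub]
  refine IsUnit.map _ (sub_ne_zero.2 fun h => hij ?_).isUnit
  exact Fin.ext (hω.pow_inj i.2 j.2 h)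

/-- If `t ^ g = a` with `a` as in `mem_range_of_pow_mul_pow_mem_range` and an automorphism `σ`
multiplies `t` by a primitive `g`-th root of unity, then the coefficients of an integral element
`∑ c i • t ^ i` lie in `A`: each summand is an eigenvector of `σ`, hence integral, and its `g`-th
power `c i ^ g * a ^ i` lies in the fraction field. -/
lemma mem_range_of_isIntegral_sum {k A K C : Type*} [Field k] [CommRing A] [IsDomain A]
    [IsNoetherianRing A] [IsIntegrallyClosed A] [Field K] [Algebra A K] [IsFractionRing A K]
    [CommRing C] [Algebra K C] [Nontrivial C] [Algebra A C] [IsScalarTower A K C] [Algebra k A]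
    {a : A} (ha : ∀ p : Ideal A, p.IsPrime → p.height = 1 → ∀ r ∉ p, r * a ∉ p ^ 2)
    {g : ℕ} {t : C} (ht : t ^ g = algebraMap A C a) {ω : k} (hω : IsPrimitiveRoot ω g)
    (σ : C →ₐ[K] C) (hσ : σ t = algebraMap k A ω • t) (c : Fin g → K)
    (hc : IsIntegral A (∑ i, c i • t ^ (i : ℕ))) (i : Fin g) : c i ∈ (algebraMap A K).range := by
  have h1 : IsIntegral A (c i • t ^ (i : ℕ)) :=
    mem_of_sum_mem_of_eigenvectors (integralClosure A C).toSubmodule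
      (σ.restrictScalars A).toLinearMap.toAddMonoidHom
      (fun m hm => IsIntegral.map (σ.restrictScalars A) hm) (fun i : Fin g => algebraMap k A ω ^ (i : ℕ))
      (fun i j hij => isUnit_pow_sub_pow hω hij)
      (fun i m => (σ.restrictScalars A).toLinearMap.map_smul _ m) Finset.univ
      (fun i => c i • t ^ (i : ℕ)) (fun i => by
        change σ _ = _
        rw [map_smul, map_pow, hσ, smul_pow, smul_comm]) hc i (Finset.mem_univ i)
  refine mem_range_of_pow_mul_pow_mem_range ha i.2 ?_
  have h2 : IsIntegral A (c i ^ g * algebraMap A K a ^ (i : ℕ)) := by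
    rw [← isIntegral_algebraMap_iff (algebraMap K C).injective (R := A)]
    convert h1.pow g using 1
    rw [smul_pow, ← pow_mul, mul_comm _ g, pow_mul, ht, map_mul, map_pow, map_pow,
      ← IsScalarTower.algebraMap_apply, Algebra.smul_def, map_pow]
  exact IsIntegrallyClosed.algebraMap_eq_of_integral h2

/-! ### Functions on the cyclic cover -/

section
variable {X : Scheme.{u}} [IsIntegral X]

/-- A rational function which is regular at all points of the affine open `U` is regular on `U`,
because its ideal of denominators is contained in no maximal ideal. -/
lemma mem_range_germToFunctionField {U : X.Opens} (hU : IsAffineOpen U) [Nonempty U]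
    {x : X.functionField} (hx : ∀ y ∈ U, x ∈ (algebraMap (X.presheaf.stalk y) X.functionField).range) :
    x ∈ (algebraMap Γ(X, U) X.functionField).range := by
  let N : Submodule Γ(X, U) X.functionField := LinearMap.range (Algebra.linearMap _ _)
  let I : Ideal Γ(X, U) := N.comap (LinearMap.toSpanSingleton Γ(X, U) X.functionField x)
  by_cases hI : I = ⊤
  · obtain ⟨a, ha⟩ : (1 : Γ(X, U)) ∈ I := hI ▸ Submodule.mem_top
    exact ⟨a, ha.trans (one_smul _ x)⟩
  exfalso
  -- The ideal `I` of denominators of `x` lies in a maximal ideal, but `x` is regular at that point.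
  obtain ⟨m, hm, hle⟩ := Ideal.exists_le_maximal I hI
  let p : PrimeSpectrum Γ(X, U) := ⟨m, hm.isPrime⟩
  have hp : hU.fromSpec p ∈ U := (hU.isoSpec.inv p).2
  obtain ⟨b, hb⟩ := hx _ hp
  let : Algebra Γ(X, U) (X.presheaf.stalk (hU.fromSpec p)) :=
    TopCat.Presheaf.algebra_section_stalk X.presheaf ⟨_, hp⟩
  have := functionField_isScalarTower X U ⟨_, hp⟩
  have : IsLocalization.AtPrime (X.presheaf.stalk (hU.fromSpec p)) p.asIdeal :=
    hU.isLocalization_stalk' p hp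
  obtain ⟨⟨n, r⟩, hr⟩ := IsLocalization.surj p.asIdeal.primeCompl b
  refine r.2 (hle ⟨n, ?_⟩)
  change algebraMap _ _ n = r.1 • x
  have h := congrArg (algebraMap _ X.functionField) hr
  rw [map_mul, hb, ← IsScalarTower.algebraMap_apply, ← IsScalarTower.algebraMap_apply] at h
  rw [← h, Algebra.smul_def, mul_comm]

lemma isIntegrallyClosed_section (hX : IsNormal X) {U : X.Opens} (hU : IsAffineOpen U)
    [Nonempty U] : IsIntegrallyClosed Γ(X, U) := by
  have := functionField_isFractionRing_of_isAffineOpen X U hU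
  refine (isIntegrallyClosed_iff X.functionField).2 fun {x} hx => ?_
  refine mem_range_germToFunctionField hU fun y hy => ?_
  have := (hX y).2
  let : Algebra Γ(X, U) (X.presheaf.stalk y) :=
    TopCat.Presheaf.algebra_section_stalk X.presheaf ⟨_, hy⟩
  have := functionField_isScalarTower X U ⟨_, hy⟩
  exact IsIntegrallyClosed.algebraMap_eq_of_integral (hx.tower_top (A := X.presheaf.stalk y))

/-- The rational function `h` is a local equation of the Cartier divisor `H` on `U`, i.e. its inverse
generates the line bundle of `H` on `U`. -/
def IsLocalEquation (H : CartierDivisor X) (U : X.Opens) (h : X.functionField) : Prop :=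
  ∀ y ∈ U, ∃ v : (X.presheaf.stalk y)ˣ,
    H.eqn y = algebraMap (X.presheaf.stalk y) X.functionField v * h

/-- On an affine open where `h` is a local equation of `H`, the section `s` is given by a function
`a = s * h ^ g`, which vanishes to order at most one along primes of height one. -/
lemma IsLocalEquation.exists_section {H : CartierDivisor X} {g : ℕ} {s h : X.functionField}
    (hs : IsReducedSection H g s) {U : X.Opens} (hU : IsAffineOpen U) [Nonempty U]
    (hh : IsLocalEquation H U h) :
    ∃ a : Γ(X, U), algebraMap Γ(X, U) X.functionField a = s * h ^ g ∧
      ∀ p : Ideal Γ(X, U), p.IsPrime → p.height = 1 → ∀ r ∉ p, r * a ∉ p ^ 2 := by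
  have hsh : ∀ y ∈ U, s * h ^ g ∈ (algebraMap (X.presheaf.stalk y) X.functionField).range := by
    intro y hy
    obtain ⟨v, hv⟩ := hh y hy
    obtain ⟨b, hb⟩ := hs.regular y
    have hvv : algebraMap (X.presheaf.stalk y) X.functionField ↑v *
        algebraMap (X.presheaf.stalk y) X.functionField ↑v⁻¹ = 1 := by
      rw [← map_mul, Units.mul_inv, map_one]
    refine ⟨b * ↑v⁻¹ ^ g, ?_⟩
    rw [map_mul, hb, hv, map_pow, mul_assoc, ← mul_pow, mul_right_comm, hvv, one_mul]
  obtain ⟨a, ha⟩ := mem_range_germToFunctionField hU hsh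
  refine ⟨a, ha, fun p hp hht r hr hra => ?_⟩
  let q : PrimeSpectrum Γ(X, U) := ⟨p, hp⟩
  have hq : hU.fromSpec q ∈ U := (hU.isoSpec.inv q).2
  let S := X.presheaf.stalk (hU.fromSpec q)
  let : Algebra Γ(X, U) S := TopCat.Presheaf.algebra_section_stalk X.presheaf ⟨_, hq⟩
  have := functionField_isScalarTower X U ⟨_, hq⟩
  have hloc : IsLocalization.AtPrime S p := hU.isLocalization_stalk' q hq
  have hco : Order.coheight (hU.fromSpec q) = 1 := by
    have h1 := ringKrullDim_stalk_eq_coheight (hU.fromSpec q)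
    rw [IsLocalization.AtPrime.ringKrullDim_eq_height p S, hht] at h1
    exact_mod_cast h1.symm
  obtain ⟨v, hv⟩ := hh _ hq
  refine hs.reduced _ hco (algebraMap Γ(X, U) S a * ↑(v ^ g)) ?_ ?_
  · rw [map_mul, ← IsScalarTower.algebraMap_apply, ha, hv, mul_pow, Units.val_pow_eq_pow_val, map_pow]
    ring
  · refine Ideal.mul_mem_right _ _ ?_
    have hru : IsUnit (algebraMap Γ(X, U) S r) := IsLocalization.map_units S (⟨r, hr⟩ : p.primeCompl)
    have h1 := Ideal.mem_map_of_mem (algebraMap Γ(X, U) S) hra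
    rw [Ideal.map_pow, IsLocalization.AtPrime.map_eq_maximalIdeal p S, map_mul] at h1
    exact (Ideal.unit_mul_mem_iff_mem _ hru).1 h1

/-- The powers of `h * T` with exponent less than `g` form a basis of `K[T] / (T ^ g - s)`. -/
lemma bijective_sum_smul_root_pow {K : Type*} [Field K] {g : ℕ} (hg : 0 < g) (s : K) {h : K}
    (hh : h ≠ 0) :
    Function.Bijective fun c : Fin g → K => ∑ i, c i •
      (algebraMap K (AdjoinRoot (Polynomial.X ^ g - Polynomial.C s)) h *
        AdjoinRoot.root (Polynomial.X ^ g - Polynomial.C s)) ^ (i : ℕ) := by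
  have hm := Polynomial.monic_X_pow_sub_C s hg.ne'
  let b := (AdjoinRoot.powerBasis' hm).basis.reindex
    (finCongr (Polynomial.natDegree_X_pow_sub_C (n := g) (r := s)))
  have hb (i : Fin g) : b i = AdjoinRoot.root (Polynomial.X ^ g - Polynomial.C s) ^ (i : ℕ) := by
    rw [Module.Basis.reindex_apply, (AdjoinRoot.powerBasis' hm).basis_eq_pow]
    rfl
  have h1 : Function.Bijective fun (c : Fin g → K) (i : Fin g) => c i * h ^ (i : ℕ) := by
    have : ∀ i : Fin g, h ^ (i : ℕ) ≠ 0 := fun i => pow_ne_zero _ hh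
    refine ⟨fun c c' hc => funext fun i => mul_right_cancel₀ (this i) (congrFun hc i),
      fun c => ⟨fun i => c i * (h ^ (i : ℕ))⁻¹, funext fun i => ?_⟩⟩
    exact inv_mul_cancel_right₀ (this i) _
  convert b.equivFun.symm.bijective.comp h1 using 1
  funext c
  simp only [Function.comp_apply, Module.Basis.equivFun_symm_apply, hb, mul_pow,
    ← map_pow, Algebra.smul_def, mul_assoc, map_mul]

variable {g : ℕ} {s : X.functionField}

/-- Restriction of functions on the cyclic cover to its ring of rational functions. -/
def coverFunctions (g : ℕ) (s : X.functionField) (V : (cyclicCover g s).Opens)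
    (hV : ⊤ ≤ (coverGeneric g s).toNormalization ⁻¹ᵁ V) : Γ(cyclicCover g s, V) →+* coverRing g s :=
  ((coverGeneric g s).toNormalization.appLE V ⊤ hV ≫
    (Scheme.ΓSpecIso (CommRingCat.of (coverRing g s))).hom).hom

/-- A form of `appLE_comp_appLE` for a composite given up to equality of morphisms. -/
lemma appLE_appLE_of_comp_eq {Z Y T : Scheme.{u}} {p : Z ⟶ Y} {q : Y ⟶ T} {r : Z ⟶ T}
    (h : p ≫ q = r) {U : T.Opens} {V : Y.Opens} {W : Z.Opens} (hV : V ≤ q ⁻¹ᵁ U)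
    (hW : W ≤ p ⁻¹ᵁ V) (hWU : W ≤ r ⁻¹ᵁ U) :
    q.appLE U V hV ≫ p.appLE V W hW = r.appLE U W hWU := by
  subst h
  exact Scheme.Hom.appLE_comp_appLE ..

lemma appLE_comm_of_comp_eq {Z Y : Scheme.{u}} {p : Z ⟶ Y} {σ : Y ⟶ Y} {ρ : Z ⟶ Z}
    (h : p ≫ σ = ρ ≫ p) {V : Y.Opens} {W : Z.Opens} (hV : V ≤ σ ⁻¹ᵁ V) (hW : W ≤ p ⁻¹ᵁ V)
    (hρ : W ≤ ρ ⁻¹ᵁ W) :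
    σ.appLE V V hV ≫ p.appLE V W hW = p.appLE V W hW ≫ ρ.appLE W W hρ := by
  have h1 : W ≤ (ρ ≫ p) ⁻¹ᵁ V := fun x hx => hW (hρ hx)
  exact (appLE_appLE_of_comp_eq h hV hW h1).trans (appLE_appLE_of_comp_eq rfl hW hρ h1).symm

lemma genericPoint_mem (U : X.Opens) [Nonempty U] : genericPoint X ∈ U :=
  ((genericPoint_spec X).mem_open_set_iff U.isOpen).mpr (by simpa using ‹Nonempty U›)

lemma coverGeneric_preimage (U : X.Opens) [Nonempty U] : coverGeneric g s ⁻¹ᵁ U = ⊤ := by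
  refine top_le_iff.1 fun x _ => ?_
  have h : coverGeneric g s x ⤳ genericPoint X := by
    have : coverGeneric g s x ∈ Set.range (X.fromSpecStalk (genericPoint X)) :=
      ⟨Spec.map (CommRingCat.ofHom (algebraMap X.functionField (coverRing g s))) x, by
        rw [← Scheme.Hom.comp_apply]; rfl⟩
    rwa [Scheme.range_fromSpecStalk] at this
  exact h.mem_open U.isOpen (genericPoint_mem U)

lemma coverGeneric_appLE (U : X.Opens) [Nonempty U] (h) :
    (coverGeneric g s).appLE U ⊤ h ≫ (Scheme.ΓSpecIso (CommRingCat.of (coverRing g s))).hom =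
      X.germToFunctionField U ≫
        CommRingCat.ofHom (algebraMap X.functionField (coverRing g s)) := by
  have hU (x) : X.fromSpecStalk (genericPoint X) x ∈ U := by
    have : X.fromSpecStalk (genericPoint X) x ∈ Set.range (X.fromSpecStalk (genericPoint X)) :=
      ⟨x, rfl⟩
    rw [Scheme.range_fromSpecStalk] at this
    exact Specializes.mem_open this U.isOpen (genericPoint_mem U)
  have h0 : (X.fromSpecStalk (genericPoint X)).appLE U ⊤ (fun x _ => hU x) =
      X.germToFunctionField U ≫ (Scheme.ΓSpecIso X.functionField).inv := by
    change (X.fromSpecStalk (genericPoint X)).app U ≫ _ = _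
    rw [Scheme.fromSpecStalk_app (genericPoint_mem U), Category.assoc,
      Category.assoc, ← Functor.map_comp]
    exact congr(_ ≫ _ ≫ $((Spec X.functionField).presheaf.map_id _)).trans
      congr(_ ≫ $(Category.comp_id _))
  have h1 := appLE_appLE_of_comp_eq (r := coverGeneric g s) rfl (V := ⊤) (fun x _ => hU x)
    (p := Spec.map (CommRingCat.ofHom (algebraMap X.functionField (coverRing g s)))) (W := ⊤)
    (fun _ _ => trivial) h
  have h2 : (Spec.map (CommRingCat.ofHom (algebraMap X.functionField (coverRing g s)))).appLE
      ⊤ ⊤ le_top = (Spec.map (CommRingCat.ofHom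
        (algebraMap X.functionField (coverRing g s)))).appTop := Scheme.Hom.appLE_eq_app _
  rw [h0, h2, Category.assoc, ← Scheme.ΓSpecIso_inv_naturality] at h1
  rw [← h1, Category.assoc, Category.assoc, Iso.inv_hom_id, Category.comp_id]
  rfl

lemma toNormalization_preimage_top (U : X.Opens) [Nonempty U] :
    ⊤ ≤ (coverGeneric g s).toNormalization ⁻¹ᵁ (coverMap g s ⁻¹ᵁ U) := by
  rw [← Scheme.Hom.comp_preimage, Scheme.Hom.toNormalization_fromNormalization,
    coverGeneric_preimage]

lemma coverFunctions_app (U : X.Opens) [Nonempty U] (a : Γ(X, U)) :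
    coverFunctions g s (coverMap g s ⁻¹ᵁ U) (toNormalization_preimage_top U)
      ((coverMap g s).app U a) =
      algebraMap X.functionField (coverRing g s) (algebraMap Γ(X, U) X.functionField a) := by
  have h := coverGeneric_appLE (g := g) (s := s) U (coverGeneric_preimage U).ge
  have h1 : (coverMap g s).app U ≫ (coverGeneric g s).toNormalization.appLE (coverMap g s ⁻¹ᵁ U) ⊤
      (toNormalization_preimage_top U) =
      (coverGeneric g s).appLE U ⊤ (coverGeneric_preimage U).ge := by
    rw [Scheme.Hom.app_eq_appLE]
    exact appLE_appLE_of_comp_eq (Scheme.Hom.toNormalization_fromNormalization _) _ _ _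
  rw [← h1] at h
  exact congr($h a)

/-- The deck transformation of `ζ` acts on functions through `T ↦ ζ T`. -/
lemma coverFunctions_deck (ζ : rootsOfUnity g X.functionField) (U : X.Opens) [Nonempty U] (h)
    (b : Γ(cyclicCover g s, coverMap g s ⁻¹ᵁ U)) :
    coverFunctions g s _ (toNormalization_preimage_top U)
      ((deck g s ζ).appLE (coverMap g s ⁻¹ᵁ U) (coverMap g s ⁻¹ᵁ U) h b) =
      rootHom g s ζ (coverFunctions g s _ (toNormalization_preimage_top U) b) := by
  let ρ := CommRingCat.ofHom (rootHom g s ζ).toRingHom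
  have h1 : (coverGeneric g s).toNormalization ≫ deck g s ζ =
      Spec.map ρ ≫ (coverGeneric g s).toNormalization :=
    Scheme.Hom.toNormalization_normalizationDesc _ _ _ _
  have h2 : (deck g s ζ).appLE (coverMap g s ⁻¹ᵁ U) (coverMap g s ⁻¹ᵁ U) h ≫
      (coverGeneric g s).toNormalization.appLE _ ⊤ (toNormalization_preimage_top U) =
      (coverGeneric g s).toNormalization.appLE _ ⊤ (toNormalization_preimage_top U) ≫
        (Spec.map ρ).appTop := by
    have h3 : (Spec.map ρ).appTop = (Spec.map ρ).appLE ⊤ ⊤ le_top :=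
      Scheme.Hom.app_eq_appLE _
    rw [h3]
    exact appLE_comm_of_comp_eq h1 h (toNormalization_preimage_top U) le_top
  have h4 := congr($h2 ≫ (Scheme.ΓSpecIso (CommRingCat.of (coverRing g s))).hom)
  rw [Category.assoc, Category.assoc, Scheme.ΓSpecIso_naturality] at h4
  exact congr($h4 b)

/-- The sections of the spectrum of the ring of rational functions over the preimage of
a nonempty open, which is everything. -/
def coverSections (U : X.Opens) [Nonempty U] :
    Γ(Spec (CommRingCat.of (coverRing g s)), coverGeneric g s ⁻¹ᵁ U) ≅
      CommRingCat.of (coverRing g s) :=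
  (Spec (CommRingCat.of (coverRing g s))).presheaf.mapIso
    (eqToIso (coverGeneric_preimage U).symm).op ≪≫ Scheme.ΓSpecIso _

/-- Over an affine open `U`, functions on the cyclic cover are identified with the integral closure of
`Γ(X, U)` in the ring of rational functions. -/
lemma coverFunctions_eq {U : X.Opens} (hU : IsAffineOpen U) [Nonempty U] :
    let := ((coverGeneric g s).app U).hom.toAlgebra
    CommRingCat.ofHom (coverFunctions g s (coverMap g s ⁻¹ᵁ U) (toNormalization_preimage_top U)) =
      ((coverGeneric g s).normalizationObjIso hU).hom ≫
        CommRingCat.ofHom (Subalgebra.val _).toRingHom ≫ (coverSections U).hom := by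
  intro _
  have h := congr($((coverGeneric g s).normalizationObjIso_hom_val hU) ≫
    (coverSections U).hom)
  refine Eq.trans ?_ (h.symm.trans (Category.assoc _ _ _))
  rw [coverSections, Iso.trans_hom, Functor.mapIso_hom]
  erw [Scheme.Hom.appLE_map_assoc]
  rfl

lemma coverFunctions_injective {U : X.Opens} (hU : IsAffineOpen U) [Nonempty U] :
    Function.Injective
      (coverFunctions g s (coverMap g s ⁻¹ᵁ U) (toNormalization_preimage_top U)) := by
  let := ((coverGeneric g s).app U).hom.toAlgebra
  have h := coverFunctions_eq (g := g) (s := s) hU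
  have h1 : ⇑(coverFunctions g s (coverMap g s ⁻¹ᵁ U) (toNormalization_preimage_top U)) =
      (coverSections U).commRingCatIsoToRingEquiv ∘ Subtype.val ∘
        ((coverGeneric g s).normalizationObjIso hU).commRingCatIsoToRingEquiv :=
    funext fun b => congr($h b)
  rw [h1]
  exact (RingEquiv.injective _).comp (Subtype.val_injective.comp (RingEquiv.injective _))

lemma mem_range_coverFunctions {U : X.Opens} (hU : IsAffineOpen U) [Nonempty U]
    (c : coverRing g s) (hc : ((algebraMap X.functionField (coverRing g s)).comp
        (algebraMap Γ(X, U) X.functionField)).IsIntegralElem c) :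
    c ∈ (coverFunctions g s (coverMap g s ⁻¹ᵁ U) (toNormalization_preimage_top U)).range := by
  let := ((coverGeneric g s).app U).hom.toAlgebra
  have h := coverFunctions_eq (g := g) (s := s) hU
  let e := (coverSections (g := g) (s := s) U).commRingCatIsoToRingEquiv
  obtain ⟨x, rfl⟩ := e.surjective c
  have hx : ((coverGeneric g s).app U).hom.IsIntegralElem x := by
    rw [← RingHom.IsIntegralElem.map_iff (g := (e : _ →+* coverRing g s)) e.injective]
    refine Eq.mp (congrArg (fun φ : _ →+* coverRing g s => φ.IsIntegralElem (e x)) ?_) hc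
    have h1 := coverGeneric_appLE (g := g) (s := s) U (coverGeneric_preimage U).ge
    exact congr(CommRingCat.Hom.hom $h1).symm
  let e' := ((coverGeneric g s).normalizationObjIso hU).commRingCatIsoToRingEquiv
  obtain ⟨b, hb⟩ := e'.surjective ⟨x, hx⟩
  refine ⟨b, ?_⟩
  have h2 := congr($h b)
  refine h2.trans (congrArg e ?_)
  exact congrArg Subtype.val hb

lemma isIntegralElem_coverFunctions {U : X.Opens} (hU : IsAffineOpen U) [Nonempty U]
    (b : Γ(cyclicCover g s, coverMap g s ⁻¹ᵁ U)) :
    ((algebraMap X.functionField (coverRing g s)).comp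
      (algebraMap Γ(X, U) X.functionField)).IsIntegralElem
        (coverFunctions g s (coverMap g s ⁻¹ᵁ U) (toNormalization_preimage_top U) b) := by
  have h := IsIntegralHom.isIntegral_app (coverMap g s) U hU b
  have h1 := h.map (coverFunctions g s (coverMap g s ⁻¹ᵁ U) (toNormalization_preimage_top U))
  convert h1 using 1
  exact RingHom.ext fun a => (coverFunctions_app U a).symm

end

/-! ### Kummer generators -/

section
variable {X : Scheme.{u}} [IsIntegral X] {g : ℕ} {s : X.functionField}

lemma le_preimage_of_comp_eq {Y T : Scheme.{u}} {π : Y ⟶ T} {σ : Y ⟶ Y} (h : σ ≫ π = π)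
    (U : T.Opens) : π ⁻¹ᵁ U ≤ σ ⁻¹ᵁ (π ⁻¹ᵁ U) := by
  rw [← Scheme.Hom.comp_preimage, h]

/-- The function `t` on the part of the cyclic cover over `U` is a Kummer generator: functions on the
cover are uniquely of the form `∑ c i * t ^ i` with `i < g` and `c i` functions on `U`, `t` is not a
zero divisor, and some deck transformation multiplies `t` by a function `z` on `U` whose powers
`z ^ i`, `i < g`, differ by units (in practice, a primitive `g`-th root of unity). -/
structure IsKummerGenerator (g : ℕ) (s : X.functionField) (U : X.Opens)
    (t : Γ(cyclicCover g s, coverMap g s ⁻¹ᵁ U)) : Prop where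
  bijective : Function.Bijective fun c : Fin g → Γ(X, U) =>
    ∑ i, (coverMap g s).app U (c i) * t ^ (i : ℕ)
  mem_nonZeroDivisors : t ∈ nonZeroDivisors Γ(cyclicCover g s, coverMap g s ⁻¹ᵁ U)
  exists_deck : ∃ (ζ : rootsOfUnity g X.functionField) (z : Γ(X, U)),
    (∀ i j : Fin g, i ≠ j → IsUnit (z ^ (i : ℕ) - z ^ (j : ℕ))) ∧
    (deck g s ζ).appLE _ _ (le_preimage_of_comp_eq (deck_coverMap g s ζ) U) t =
      (coverMap g s).app U z * t

/-- Where `h` is a local equation of `H`, the element `h * T` of the ring of rational functions is a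
Kummer generator. -/
lemma exists_isKummerGenerator (hX : IsNormal X) {k : Type*} [Field k] {ω : k}
    (hω : IsPrimitiveRoot ω g) (hg : 0 < g) {H : CartierDivisor X}
    (hs : IsReducedSection H g s) {U : X.Opens} (hU : IsAffineOpen U) [Nonempty U]
    (κ : k →+* Γ(X, U)) [IsNoetherianRing Γ(X, U)]
    {h : X.functionField} (hh0 : h ≠ 0) (hh : IsLocalEquation H U h) :
    ∃ t, IsKummerGenerator g s U t := by
  obtain ⟨a, ha, hred⟩ := hh.exists_section hs hU
  have := functionField_isFractionRing_of_isAffineOpen X U hU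
  have := isIntegrallyClosed_section hX hU
  let _ : Algebra k Γ(X, U) := κ.toAlgebra
  have : IsScalarTower Γ(X, U) X.functionField (coverRing g s) := inferInstance
  have : Nontrivial (coverRing g s) := AdjoinRoot.nontrivial _ (by
    rw [Polynomial.degree_X_pow_sub_C hg]
    exact_mod_cast hg.ne')
  let θ := coverFunctions g s (coverMap g s ⁻¹ᵁ U) (toNormalization_preimage_top U)
  have hθ : Function.Injective θ := coverFunctions_injective hU
  have hθπ (c : Γ(X, U)) : θ ((coverMap g s).app U c) = algebraMap Γ(X, U) (coverRing g s) c :=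
    coverFunctions_app U c
  let r : coverRing g s := AdjoinRoot.root (Polynomial.X ^ g - Polynomial.C s)
  have hr : r ^ g = algebraMap X.functionField (coverRing g s) s := by
    have h1 := AdjoinRoot.eval₂_root (Polynomial.X ^ g - Polynomial.C s)
    simp only [Polynomial.eval₂_sub, Polynomial.eval₂_pow, Polynomial.eval₂_X,
      Polynomial.eval₂_C] at h1
    exact sub_eq_zero.1 h1
  -- `τ = h * T` satisfies `τ ^ g = a`, so it is integral and comes from a function `t`.
  let τ : coverRing g s := algebraMap X.functionField (coverRing g s) h * r
  have hτ : τ ^ g = algebraMap Γ(X, U) (coverRing g s) a := by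
    rw [mul_pow, hr, ← map_pow, ← map_mul, mul_comm, ← ha]
    rfl
  have hτu : IsUnit τ := by
    refine (isUnit_pow_iff hg.ne').1 ?_
    rw [mul_pow, hr, ← map_pow, ← map_mul]
    exact (mul_ne_zero (pow_ne_zero g hh0) hs.ne_zero).isUnit.map _
  have hbij := bijective_sum_smul_root_pow hg s hh0
  obtain ⟨t, ht⟩ : τ ∈ θ.range := by
    refine mem_range_coverFunctions hU _ ?_
    refine IsIntegral.of_pow (R := Γ(X, U)) hg (x := τ) ?_
    rw [hτ]
    exact isIntegral_algebraMap
  let z : Γ(X, U) := κ ω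
  have hz : IsPrimitiveRoot (algebraMap Γ(X, U) X.functionField z) g :=
    hω.map_of_injective (f := (algebraMap Γ(X, U) X.functionField).comp κ) (RingHom.injective _)
  have : NeZero g := ⟨hg.ne'⟩
  let ζ : rootsOfUnity g X.functionField := hz.toRootsOfUnity
  have hζ : rootHom g s ζ τ = z • τ := by
    have h1 : rootHom g s ζ r = algebraMap X.functionField (coverRing g s)
        (algebraMap Γ(X, U) X.functionField z) * r := by
      change rootHom g s ζ (AdjoinRoot.root _) = _
      rw [rootHom]
      exact AdjoinRoot.liftAlgHom_root ..
    change rootHom g s ζ (algebraMap X.functionField (coverRing g s) h * r) = _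
    rw [map_mul, AlgHom.commutes, h1, Algebra.smul_def]
    exact mul_left_comm _ _ _
  have hsum (c : Fin g → Γ(X, U)) : θ (∑ i, (coverMap g s).app U (c i) * t ^ (i : ℕ)) =
      ∑ i, algebraMap Γ(X, U) X.functionField (c i) • τ ^ (i : ℕ) := by
    rw [map_sum]
    refine Finset.sum_congr rfl fun i _ => ?_
    rw [map_mul, map_pow, ht, hθπ, Algebra.smul_def]
    rfl
  refine ⟨t, ⟨⟨fun c c' hc => ?_, fun b => ?_⟩, ?_, ζ, z, ?_, ?_⟩⟩
  · have h1 := (hsum c).symm.trans ((congrArg θ hc).trans (hsum c'))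
    have h2 := hbij.1 h1
    funext i
    exact IsFractionRing.injective Γ(X, U) X.functionField (congrFun h2 i)
  · obtain ⟨c, hc⟩ := hbij.2 (θ b)
    have hint : IsIntegral Γ(X, U) (∑ i, c i • τ ^ (i : ℕ)) := by
      refine Eq.mpr (congrArg (IsIntegral Γ(X, U)) hc) ?_
      exact isIntegralElem_coverFunctions hU b
    have h1 := mem_range_of_isIntegral_sum hred hτ hω (rootHom g s ζ) hζ c hint
    choose c' hc' using h1
    refine ⟨c', hθ ?_⟩
    refine (hsum c').trans (Eq.trans ?_ hc)
    exact Finset.sum_congr rfl fun i _ => congrArg (· • τ ^ (i : ℕ)) (hc' i)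
  · rw [mem_nonZeroDivisors_iff_right]
    intro x hx
    refine (injective_iff_map_eq_zero θ).1 hθ x ?_
    have h1 := congrArg θ hx
    rw [map_mul, ht, map_zero] at h1
    exact (hτu.mul_left_eq_zero).1 h1
  · intro i j hij
    exact isUnit_pow_sub_pow hω hij
  · refine hθ ?_
    rw [map_mul, ht, hθπ, ← Algebra.smul_def, ← hζ, ← ht]
    exact coverFunctions_deck ζ U _ t

end

/-! ### The descended submodule -/

section
open Scheme.Modules
variable {X Y : Scheme.{u}}

/-- The preimage of `D(f)` is the basic open of the pullback of `f`. -/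
lemma isLocalizingOn_pushforward (π : Y ⟶ X) (N : Y.Modules) {U : X.Opens}
    (hN : IsLocalizingOn N (π ⁻¹ᵁ U)) : IsLocalizingOn ((pushforward π).obj N) U := by
  have hle (f : Γ(X, U)) : π ⁻¹ᵁ X.basicOpen f ≤ Y.basicOpen (π.app U f) :=
    (Scheme.preimage_basicOpen π f).le
  have hge (f : Γ(X, U)) : Y.basicOpen (π.app U f) ≤ π ⁻¹ᵁ X.basicOpen f :=
    (Scheme.preimage_basicOpen π f).ge
  refine ⟨fun f s hs => ?_, fun f t => ?_⟩
  · obtain ⟨n, hn⟩ := hN.exists_pow_smul_eq_zero (π.app U f) s (by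
      have h := congrArg (N.presheaf.map (homOfLE (hge f)).op) hs
      exact (presheaf_map_map N _ _ _ _).symm.trans (h.trans (map_zero _)))
    refine ⟨n, ?_⟩
    rw [← map_pow] at hn
    exact hn
  · obtain ⟨n, s, hs⟩ := hN.exists_map_eq (π.app U f) (N.presheaf.map (homOfLE (hge f)).op t)
    refine ⟨n, s, ?_⟩
    have h := congrArg (N.presheaf.map (homOfLE (hle f)).op) hs
    rw [Scheme.Modules.map_smul] at h
    have h1 : N.presheaf.map (homOfLE (hle f)).op (N.presheaf.map (homOfLE (hge f)).op t) = t :=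
      (presheaf_map_map N _ _ (𝟙 _) _).trans congr($(N.presheaf.map_id _) t)
    refine (presheaf_map_map N (homOfLE (Y.basicOpen_le _)).op (homOfLE (hle f)).op _ s).symm.trans
      (h.trans ?_)
    rw [h1, ← map_pow]
    refine congrArg (· • (show Γ(N, π ⁻¹ᵁ X.basicOpen f) from t)) ?_
    refine (res_res _ _ _).trans ?_
    exact congr($(π.naturality (homOfLE (X.basicOpen_le f)).op) (f ^ n)).symm

lemma isLocalizingOn_of_isPullback {F G H P : X.Modules} {p : P ⟶ F} {q : P ⟶ G} {a : F ⟶ H}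
    {b : G ⟶ H} [Mono q] (h : IsPullback p q a b) {U : X.Opens} (hF : IsLocalizingOn F U)
    (hG : IsLocalizingOn G U) (hH : IsLocalizingOn H U) : IsLocalizingOn P U := by
  have hc (W : X.Opens) (z : Γ(P, W)) : a.app W (p.app W z) = b.app W (q.app W z) :=
    congr(Hom.app $(h.w) W z)
  refine ⟨fun f s hs => ?_, fun f t => ?_⟩
  · obtain ⟨n, hn⟩ := hG.exists_pow_smul_eq_zero f (q.app U s) (by
      rw [← app_map, hs, map_zero])
    exact ⟨n, app_injective q U (by rw [Hom.app_smul, hn, map_zero])⟩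
  · obtain ⟨n, x, hx⟩ := hF.exists_map_eq f (p.app _ t)
    obtain ⟨m, y, hy⟩ := hG.exists_map_eq f (q.app _ t)
    obtain ⟨k, hk⟩ := hH.exists_pow_smul_eq_zero f (a.app U (f ^ m • x) - b.app U (f ^ n • y)) (by
      rw [map_sub, ← app_map, ← app_map, Scheme.Modules.map_smul, Scheme.Modules.map_smul, hx, hy,
        smul_smul, smul_smul, Hom.app_smul, Hom.app_smul, hc, ← map_mul, ← map_mul, mul_comm,
        sub_self])
    rw [smul_sub, sub_eq_zero, ← Hom.app_smul, ← Hom.app_smul] at hk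
    obtain ⟨z, -, hz⟩ := exists_app_eq_of_isPullback h U _ _ hk
    refine ⟨k + n + m, z, app_injective q _ ?_⟩
    rw [app_map, hz, Hom.app_smul, Scheme.Modules.map_smul, Scheme.Modules.map_smul, hy, smul_smul,
      smul_smul, ← map_mul, ← map_mul, pow_add, pow_add]

lemma isPullbackMap_pullbackUnit (π : Y ⟶ X) (M : X.Modules) :
    IsPullbackMap π (pullbackUnit π M) :=
  isPullbackMap_of_adjunction (pullbackPushforwardAdjunction π) M

/-- The submodule of `T` of sections whose pullback to `Y` lies in `F`, for a submodule `F` of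
`π^* T`: the fibre product of `π_* F` and `T` over `π_* π^* T`. -/
def descent {π : Y ⟶ X} {T : X.Modules} {F : Y.Modules}
    (i : F ⟶ (Scheme.Modules.pullback π).obj T) : X.Modules :=
  Limits.pullback ((pushforward π).map i) (pullbackUnit π T)

section
variable {π : Y ⟶ X} {T : X.Modules} {F : Y.Modules}
  (i : F ⟶ (Scheme.Modules.pullback π).obj T)

/-- The inclusion of `descent i` into `T`. -/
def descentι : descent i ⟶ T := Limits.pullback.snd _ _

/-- Pullback of sections of `descent i` to sections of `F`. -/
def descentToPushforward : descent i ⟶ (pushforward π).obj F := Limits.pullback.fst _ _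

/-- The canonical map `π^* (descent i) ⟶ F`. -/
def pullbackDescent : (Scheme.Modules.pullback π).obj (descent i) ⟶ F :=
  ((pullbackPushforwardAdjunction π).homEquiv _ _).symm (descentToPushforward i)

lemma isPullback_descent : IsPullback (descentToPushforward i) (descentι i)
    ((pushforward π).map i) (pullbackUnit π T) :=
  IsPullback.of_hasPullback _ _

instance [Mono i] : Mono (descentι i) := by
  have : (pushforward π).IsRightAdjoint := (pullbackPushforwardAdjunction π).isRightAdjoint
  have : Mono ((pushforward π).map i) := inferInstance
  exact Limits.pullback.snd_of_mono

lemma pullbackDescent_comp : pullbackDescent i ≫ i =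
    (Scheme.Modules.pullback π).map (descentι i) := by
  apply ((pullbackPushforwardAdjunction π).homEquiv _ _).injective
  rw [Adjunction.homEquiv_naturality_right, pullbackDescent, Equiv.apply_symm_apply,
    (isPullback_descent i).w, Adjunction.homEquiv_unit]
  exact (pullbackPushforwardAdjunction π).unit.naturality _

lemma pullbackUnit_pullbackDescent : pullbackUnit π (descent i) ≫
    (pushforward π).map (pullbackDescent i) = descentToPushforward i := by
  rw [← Adjunction.homEquiv_unit, pullbackDescent, Equiv.apply_symm_apply]

lemma isLocalizingOn_descent [Mono i] [IsAffineHom π] [T.IsQuasicoherent] [F.IsQuasicoherent]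
    {U : X.Opens} (hU : IsAffineOpen U) : IsLocalizingOn (descent i) U := by
  have hV : IsAffineOpen (π ⁻¹ᵁ U) := hU.preimage π
  have := (isPullbackMap_pullbackUnit π T).isQuasicoherent
  exact isLocalizingOn_of_isPullback (isPullback_descent i)
    (isLocalizingOn_pushforward π _ (isLocalizingOn_of_isQuasicoherent hV _))
    (isLocalizingOn_of_isQuasicoherent hU _)
    (isLocalizingOn_pushforward π _ (isLocalizingOn_of_isQuasicoherent hV _))
end

lemma sectionMap_le_rfl {M : X.Modules} {N : Y.Modules} {g : Y ⟶ X} (α : M ⟶ (pushforward g).obj N)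
    (U : X.Opens) (m : Γ(M, U)) :
    sectionMap α (le_refl (g ⁻¹ᵁ U)) m = (show Γ(N, g ⁻¹ᵁ U) from α.app U m) :=
  congr($(N.presheaf.map_id _) _)

/-- If the sections of `M` localize on the affine open `U`, then their finite generation can be
checked on basic opens covering `U`. -/
lemma finite_of_isLocalizingOn {M : X.Modules} {U : X.Opens} (hU : IsAffineOpen U)
    (hM : IsLocalizingOn M U) (S : Set Γ(X, U)) (hS : Ideal.span S = ⊤)
    (h : ∀ f ∈ S, Module.Finite Γ(X, X.basicOpen f) Γ(M, X.basicOpen f)) :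
    Module.Finite Γ(X, U) Γ(M, U) := by
  have key (f) (hf : f ∈ S) : ∃ G : Finset Γ(M, U), ∀ w : Γ(M, U), ∃ n : ℕ,
      f ^ n • w ∈ Submodule.span Γ(X, U) (G : Set Γ(M, U)) := by
    classical
    obtain ⟨G, hG⟩ := (h f hf).fg_top
    choose n s hs using fun t => hM.exists_map_eq f t
    refine ⟨G.image s, fun w => ?_⟩
    have hspan (v : Γ(M, X.basicOpen f)) : ∃ (k : ℕ),
        ∃ w' ∈ Submodule.span Γ(X, U) ((G.image s : Finset Γ(M, U)) : Set Γ(M, U)),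
        M.presheaf.map (homOfLE (X.basicOpen_le f)).op w' =
          X.presheaf.map (homOfLE (X.basicOpen_le f)).op (f ^ k) • v := by
      have hv : v ∈ Submodule.span Γ(X, X.basicOpen f) (G : Set Γ(M, X.basicOpen f)) :=
        hG ▸ Submodule.mem_top
      induction hv using Submodule.span_induction with
      | mem v hv =>
        exact ⟨n v, s v, Submodule.subset_span (Finset.mem_coe.2 (Finset.mem_image_of_mem s hv)),
          hs v⟩
      | zero => exact ⟨0, 0, zero_mem _, by rw [map_zero, smul_zero]⟩
      | add v₁ v₂ _ _ h₁ h₂ =>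
        obtain ⟨k₁, w₁, hw₁, e₁⟩ := h₁
        obtain ⟨k₂, w₂, hw₂, e₂⟩ := h₂
        refine ⟨k₁ + k₂, f ^ k₂ • w₁ + f ^ k₁ • w₂,
          add_mem (Submodule.smul_mem _ _ hw₁) (Submodule.smul_mem _ _ hw₂), ?_⟩
        rw [map_add, Scheme.Modules.map_smul, Scheme.Modules.map_smul, e₁, e₂, smul_smul, smul_smul,
          ← map_mul, ← map_mul, ← pow_add, ← pow_add, smul_add, add_comm k₂]
      | smul a v _ h =>
        obtain ⟨k, w, hw, e⟩ := h
        obtain ⟨l, b, hb⟩ := exists_res_eq_pow_mul hU f a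
        refine ⟨l + k, b • w, Submodule.smul_mem _ _ hw, ?_⟩
        rw [Scheme.Modules.map_smul, e, hb, smul_smul, smul_smul, pow_add, map_mul]
        congr 1
        ring
    obtain ⟨k, w', hw', e⟩ := hspan (M.presheaf.map (homOfLE (X.basicOpen_le f)).op w)
    obtain ⟨l, hl⟩ := hM.exists_pow_smul_eq_zero f (f ^ k • w - w') (by
      rw [map_sub, Scheme.Modules.map_smul, e, sub_self])
    refine ⟨l + k, ?_⟩
    rw [smul_sub, smul_smul, ← pow_add, sub_eq_zero] at hl
    rw [hl]
    exact Submodule.smul_mem _ _ hw'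
  choose! G hG using key
  obtain ⟨S', hS', hspan⟩ := (Ideal.span_eq_top_iff_finite S).1 hS
  classical
  refine ⟨⟨S'.biUnion G, eq_top_iff.2 fun w _ => ?_⟩⟩
  refine Submodule.mem_of_span_eq_top_of_smul_pow_mem _ (S' : Set Γ(X, U)) hspan w fun f => ?_
  obtain ⟨n, hn⟩ := hG f (hS' f.2) w
  exact ⟨n, Submodule.span_mono (Finset.coe_subset.2 (Finset.subset_biUnion_of_mem G f.2)) hn⟩

end

/-! ### Descent along the cyclic cover -/

section
open Scheme.Modules
variable {X : Scheme.{u}} [IsIntegral X] {g : ℕ} {s : X.functionField} {U : X.Opens}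
  {t : Γ(cyclicCover g s, coverMap g s ⁻¹ᵁ U)}

/-- Over `U`, the pullback of a quasi-coherent `M` is the direct sum of `g` copies of `M`, indexed
by the powers of the Kummer generator. -/
lemma IsKummerGenerator.bijective_sum_smul (ht : IsKummerGenerator g s U t) (hU : IsAffineOpen U)
    (M : X.Modules) [M.IsQuasicoherent] :
    Function.Bijective fun m : Fin g → Γ(M, U) => ∑ k : Fin g, t ^ (k : ℕ) •
      sectionMap (pullbackUnit (coverMap g s) M) (le_refl (coverMap g s ⁻¹ᵁ U)) (m k) := by
  refine ((isPullbackMap_pullbackUnit (coverMap g s) M).isSemiBaseChange hU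
    (hU.preimage (coverMap g s)) le_rfl).1.bijective_sum (fun k => t ^ (k : ℕ)) ?_
  rw [Scheme.Hom.appLE_eq_app]
  exact ht.bijective

/-- If `∑ t ^ k • η (m k)` is a section of `F`, where `η` denotes pullback of sections of `T`, then
so is each `η (m k)`: the summand `t ^ k • η (m k)` is an eigenvector of the Galois action, so it
belongs to the invariant submodule `F`, and `t ^ k` can be cancelled because `F` is saturated. -/
lemma IsKummerGenerator.exists_app_eq (ht : IsKummerGenerator g s U t) (hU : IsAffineOpen U)
    {T : X.Modules} {F : (cyclicCover g s).Modules}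
    {i : F ⟶ (Scheme.Modules.pullback (coverMap g s)).obj T} [Mono i]
    (hinv : IsGaloisInvariant g s i) (hsat : IsSaturated i)
    (y : Γ(F, coverMap g s ⁻¹ᵁ U)) (m : Fin g → Γ(T, U))
    (hy : i.app _ y = ∑ k : Fin g, t ^ (k : ℕ) •
      sectionMap (pullbackUnit (coverMap g s) T) (le_refl (coverMap g s ⁻¹ᵁ U)) (m k))
    (k : Fin g) : ∃ y', i.app (coverMap g s ⁻¹ᵁ U) y' =
      sectionMap (pullbackUnit (coverMap g s) T) (le_refl (coverMap g s ⁻¹ᵁ U)) (m k) := by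
  obtain ⟨ζ, z, hz, hσt⟩ := ht.exists_deck
  obtain ⟨e, he⟩ := hinv ζ
  have hle := le_preimage_of_comp_eq (deck_coverMap g s ζ) U
  let V := coverMap g s ⁻¹ᵁ U
  let η : Γ(T, U) → Γ((Scheme.Modules.pullback (coverMap g s)).obj T, V) :=
    sectionMap (pullbackUnit (coverMap g s) T) (le_refl (coverMap g s ⁻¹ᵁ U))
  let Φ := sectionMap (galoisMap (deck_coverMap g s ζ) T) hle
  have hΦη (m : Γ(T, U)) : Φ (η m) = η m := galoisMap_pullbackUnit_app _ T hle m
  have hσπ (a : Γ(X, U)) : (deck g s ζ).appLE V V hle ((coverMap g s).app U a) =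
      (coverMap g s).app U a := by
    have h := appLE_appLE_of_comp_eq (deck_coverMap g s ζ) (U := U) le_rfl hle le_rfl
    rw [Scheme.Hom.appLE_eq_app] at h
    exact congr($h a)
  let iV : Γ(F, V) →ₗ[Γ(cyclicCover g s, V)] Γ((Scheme.Modules.pullback (coverMap g s)).obj T, V) :=
    { toFun := i.app V
      map_add' := map_add _
      map_smul' := fun b y => Hom.app_smul i b y }
  have hmem : t ^ (k : ℕ) • η (m k) ∈ LinearMap.range iV := by
    refine mem_of_sum_mem_of_eigenvectors (LinearMap.range iV) Φ.toAddMonoidHom ?_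
      (fun k : Fin g => (coverMap g s).app U z ^ (k : ℕ)) ?_ ?_ Finset.univ
      (fun k => t ^ (k : ℕ) • η (m k)) ?_ ⟨y, hy⟩ k (Finset.mem_univ k)
    · rintro _ ⟨y, rfl⟩
      obtain ⟨y', hy'⟩ := exists_galoisMap_app_eq (deck_coverMap g s ζ) e.hom he hle y
      exact ⟨y', hy'⟩
    · intro a b hab
      rw [← map_pow, ← map_pow, ← map_sub]
      exact (hz a b hab).map _
    · intro k x
      refine (Φ.map_smulₛₗ _ _).trans (congrArg (· • Φ x) ?_)
      rw [← map_pow]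
      exact hσπ _
    · intro k
      refine (Φ.map_smulₛₗ _ _).trans ?_
      rw [hΦη, map_pow, smul_smul, ← mul_pow]
      exact congrArg (fun b => b ^ (k : ℕ) • η (m k)) hσt
  obtain ⟨y', hy'⟩ := hmem
  refine exists_app_eq_of_cokernel_eq_zero i V _ ?_
  refine hsat ⟨V, hU.preimage (coverMap g s)⟩ (t ^ (k : ℕ)) (pow_mem ht.mem_nonZeroDivisors _) _ ?_
  rw [← Hom.app_smul]
  refine (congrArg ((Limits.cokernel.π i).app V) hy').symm.trans ?_
  exact congr(Hom.app $(Limits.cokernel.condition i) V y')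

lemma IsKummerGenerator.pullbackDescent_app_bijective (ht : IsKummerGenerator g s U t)
    (hU : IsAffineOpen U) {T : X.Modules} [T.IsQuasicoherent] {F : (cyclicCover g s).Modules}
    {i : F ⟶ (Scheme.Modules.pullback (coverMap g s)).obj T} [Mono i]
    [(descent i).IsQuasicoherent]
    (hinv : IsGaloisInvariant g s i) (hsat : IsSaturated i) :
    Function.Bijective ((pullbackDescent i).app (coverMap g s ⁻¹ᵁ U)) := by
  have hT := ht.bijective_sum_smul hU T
  have hD := ht.bijective_sum_smul hU (descent i)
  have key (m : Fin g → Γ(descent i, U)) :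
      i.app _ ((pullbackDescent i).app (coverMap g s ⁻¹ᵁ U) (∑ k : Fin g, t ^ (k : ℕ) •
        sectionMap (pullbackUnit (coverMap g s) (descent i))
          (le_refl (coverMap g s ⁻¹ᵁ U)) (m k))) =
      ∑ k : Fin g, t ^ (k : ℕ) • sectionMap (pullbackUnit (coverMap g s) T)
        (le_refl (coverMap g s ⁻¹ᵁ U)) ((descentι i).app U (m k)) := by
    have h0 : pullbackUnit (coverMap g s) (descent i) ≫
        (pushforward (coverMap g s)).map (pullbackDescent i ≫ i) =
        descentι i ≫ pullbackUnit (coverMap g s) T := by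
      rw [Functor.map_comp, ← Category.assoc, pullbackUnit_pullbackDescent, (isPullback_descent i).w]
    rw [map_sum, map_sum]
    refine Finset.sum_congr rfl fun k _ => ?_
    rw [Hom.app_smul, Hom.app_smul, sectionMap_le_rfl, sectionMap_le_rfl]
    exact congrArg (t ^ (k : ℕ) • ·) congr(Hom.app $h0 U (m k))
  constructor
  · intro x x' hx
    obtain ⟨m, rfl⟩ := hD.2 x
    obtain ⟨m', rfl⟩ := hD.2 x'
    have h := hT.1 ((key m).symm.trans ((congrArg _ hx).trans (key m')))
    have h' : m = m' := funext fun k => app_injective (descentι i) U (congrFun h k)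
    rw [h']
  · intro y
    obtain ⟨m, hm⟩ := hT.2 (i.app _ y)
    have h (k : Fin g) : ∃ w : Γ(descent i, U), (descentι i).app U w = m k := by
      obtain ⟨y', hy'⟩ := ht.exists_app_eq hU hinv hsat y m hm.symm k
      rw [sectionMap_le_rfl] at hy'
      obtain ⟨w, -, hw⟩ := exists_app_eq_of_isPullback (isPullback_descent i) U y' (m k) hy'
      exact ⟨w, hw⟩
    choose w hw using h
    refine ⟨_, app_injective i _ ((key w).trans (Eq.trans ?_ hm))⟩
    simp only [hw]

/-- Over `U`, the cyclic cover is finite and the sections of `descent i` embed into those of `F`. -/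
lemma IsKummerGenerator.finite_descent (ht : IsKummerGenerator g s U t) (hg : 0 < g)
    (hU : IsAffineOpen U) [IsNoetherianRing Γ(X, U)] {T : X.Modules} [T.IsQuasicoherent]
    {F : (cyclicCover g s).Modules}
    (i : F ⟶ (Scheme.Modules.pullback (coverMap g s)).obj T) [Mono i]
    [hF : Module.Finite Γ(cyclicCover g s, coverMap g s ⁻¹ᵁ U) Γ(F, coverMap g s ⁻¹ᵁ U)] :
    Module.Finite Γ(X, U) Γ(descent i, U) := by
  let V := coverMap g s ⁻¹ᵁ U
  let _ : Algebra Γ(X, U) Γ(cyclicCover g s, V) := ((coverMap g s).app U).hom.toAlgebra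
  let _ : Module Γ(X, U) Γ(F, V) := Module.compHom _ ((coverMap g s).app U).hom
  have : IsScalarTower Γ(X, U) Γ(cyclicCover g s, V) Γ(F, V) :=
    ⟨fun a b x => mul_smul ((coverMap g s).app U a) b x⟩
  have hB : Module.Finite Γ(X, U) Γ(cyclicCover g s, V) := by
    let l : (Fin g → Γ(X, U)) →ₗ[Γ(X, U)] Γ(cyclicCover g s, V) :=
      Fintype.linearCombination Γ(X, U) fun k : Fin g => t ^ (k : ℕ)
    refine Module.Finite.of_surjective l fun b => ?_
    obtain ⟨c, hc⟩ := ht.bijective.2 b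
    refine ⟨c, Eq.trans ?_ hc⟩
    rw [Fintype.linearCombination_apply]
    rfl
  have : Module.Finite Γ(X, U) Γ(F, V) := Module.Finite.trans Γ(cyclicCover g s, V) _
  let l : Γ(descent i, U) →ₗ[Γ(X, U)] Γ(F, V) :=
    { toFun := (descentToPushforward i).app U
      map_add' := map_add _
      map_smul' := fun a x => Hom.app_smul (descentToPushforward i) a x }
  refine Module.Finite.of_injective l fun x x' hx => app_injective (descentι i) U ?_
  -- Pullback of sections of `T` is injective: `m ↦ ∑ t ^ k • η m` is, and the sum is not empty.
  have hη : (pullbackUnit (coverMap g s) T).app U ((descentι i).app U x) =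
      (pullbackUnit (coverMap g s) T).app U ((descentι i).app U x') := by
    have h (x) : (pullbackUnit (coverMap g s) T).app U ((descentι i).app U x) =
        i.app V ((descentToPushforward i).app U x) :=
      congr(Hom.app $((isPullback_descent i).w) U x).symm
    exact (h x).trans ((congrArg (i.app V) hx).trans (h x').symm)
  have h := (ht.bijective_sum_smul hU T).1 (a₁ := fun _ => (descentι i).app U x)
    (a₂ := fun _ => (descentι i).app U x') (by
      simp only [sectionMap_le_rfl]
      rw [hη])
  exact congrFun h ⟨0, hg⟩

/-- Kummer generators exist over all small affine opens; a primitive root of unity is supplied by the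
complex numbers. -/
lemma exists_isKummerGenerator_of_le {X : Scheme.{0}} [IsIntegral X] (hX : IsNormal X)
    (f : X ⟶ Spec (CommRingCat.of ℂ)) [LocallyOfFiniteType f] {H : CartierDivisor X} {g : ℕ}
    (hg : 0 < g) {s : X.functionField} (hs : IsReducedSection H g s) (x : X) :
    ∃ W : X.Opens, x ∈ W ∧ ∀ U ≤ W, IsAffineOpen U → Nonempty U →
      ∃ t, IsKummerGenerator g s U t := by
  obtain ⟨W, hxW, hW⟩ := H.locally_eq x
  have : IsLocallyNoetherian X := LocallyOfFiniteType.isLocallyNoetherian f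
  refine ⟨W, hxW, fun U hUW hU _ => ?_⟩
  have : IsNoetherianRing Γ(X, U) := IsLocallyNoetherian.component_noetherian ⟨U, hU⟩
  exact exists_isKummerGenerator hX (Complex.isPrimitiveRoot_exp g hg.ne') hg hs hU
    ((Scheme.ΓSpecIso (CommRingCat.of ℂ)).inv ≫ f.appLE ⊤ U le_top).hom (H.eqn_ne_zero x)
    fun y hy => hW y (hUW hy)

/-- Descent along a cyclic cover which has Kummer generators locally on `X`: an invariant and saturated
coherent submodule `F` of `π^* T` is the pullback of a coherent submodule of `T`. -/
theorem exists_descent {X : Scheme.{u}} [IsIntegral X] {g : ℕ} (hg : 0 < g) {s : X.functionField}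
    [IsLocallyNoetherian X]
    (h : ∀ x : X, ∃ W : X.Opens, x ∈ W ∧ ∀ U ≤ W, IsAffineOpen U → Nonempty U →
      ∃ t, IsKummerGenerator g s U t)
    {T : X.Modules} [T.IsQuasicoherent] {F : (cyclicCover g s).Modules}
    (i : F ⟶ (Scheme.Modules.pullback (coverMap g s)).obj T) [Mono i] (hF : IsCoherent F)
    (hinv : IsGaloisInvariant g s i) (hsat : IsSaturated i) :
    IsCoherent (descent i) ∧ IsIso (pullbackDescent i) := by
  have := hF.isQuasicoherent
  have hloc (U : X.Opens) (hU : IsAffineOpen U) : IsLocalizingOn (descent i) U :=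
    isLocalizingOn_descent i hU
  have hqc : (descent i).IsQuasicoherent := isQuasicoherent_of_forall_isLocalizingOn _ hloc
  refine ⟨⟨hqc, fun U => ?_⟩, ?_⟩
  · let S : Set Γ(X, U.1) := {q | Module.Finite Γ(X, X.basicOpen q) Γ(descent i, X.basicOpen q)}
    refine finite_of_isLocalizingOn U.2 (hloc U.1 U.2) S ?_ fun q hq => hq
    refine (U.2.self_le_iSup_basicOpen_iff).1 fun x hx => ?_
    obtain ⟨W, hxW, hW⟩ := h x
    obtain ⟨q, hqW, hxq⟩ := U.2.exists_basicOpen_le ⟨x, hxW⟩ hx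
    have hq := U.2.basicOpen q
    obtain ⟨t, ht⟩ := hW _ hqW hq ⟨⟨x, hxq⟩⟩
    have : IsNoetherianRing Γ(X, X.basicOpen q) :=
      IsLocallyNoetherian.component_noetherian ⟨_, hq⟩
    have := hF.finite ⟨_, hq.preimage (coverMap g s)⟩
    exact Opens.mem_iSup.2 ⟨⟨q, ht.finite_descent hg hq i⟩, hxq⟩
  · have := (isPullbackMap_pullbackUnit (coverMap g s) (descent i)).isQuasicoherent
    refine isIso_of_app_bijective _ fun y => ?_
    obtain ⟨W, hxW, hW⟩ := h (coverMap g s y)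
    obtain ⟨_, ⟨U, hU, rfl⟩, hxU, hUW⟩ := X.isBasis_affineOpens.exists_subset_of_mem_open hxW W.2
    obtain ⟨t, ht⟩ := hW U hUW hU ⟨⟨_, hxU⟩⟩
    exact ⟨_, hxU, hU.preimage _, ht.pullbackDescent_app_bijective hU hinv hsat⟩

end

end CyclicDescent

end

theorem mainTheorem8 (X : Scheme.{0}) [IsIntegral X] (hX : CyclicDescent.IsNormal X)
    (f : X ⟶ Spec (CommRingCat.of ℂ)) [IsSeparated f] [LocallyOfFiniteType f] [QuasiCompact f]
    (H : CyclicDescent.CartierDivisor X) (g : ℕ) (hg : 0 < g) (s : X.functionField)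
    (hs : CyclicDescent.IsReducedSection H g s)
    (F : (CyclicDescent.cyclicCover g s).Modules)
    (i : F ⟶ (Scheme.Modules.pullback (CyclicDescent.coverMap g s)).obj
      (CyclicDescent.tangentSheaf f)) [Mono i]
    (hF : CyclicDescent.IsCoherent F)
    (hinv : CyclicDescent.IsGaloisInvariant g s i)
    (hsat : CyclicDescent.IsSaturated i) :
    ∃ (FX : X.Modules) (j : FX ⟶ CyclicDescent.tangentSheaf f)
      (e : (Scheme.Modules.pullback (CyclicDescent.coverMap g s)).obj FX ≅ F),
      CyclicDescent.IsCoherent FX ∧ Mono j ∧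
        e.hom ≫ i = (Scheme.Modules.pullback (CyclicDescent.coverMap g s)).map j := by
  have : IsLocallyNoetherian X := LocallyOfFiniteType.isLocallyNoetherian f
  have := CyclicDescent.isQuasicoherent_tangentSheaf f
  obtain ⟨hcoh, hiso⟩ :=
    CyclicDescent.exists_descent hg (CyclicDescent.exists_isKummerGenerator_of_le hX f hg hs)
      i hF hinv hsat
  exact ⟨CyclicDescent.descent i, CyclicDescent.descentι i, asIso (CyclicDescent.pullbackDescent i),
    hcoh, inferInstance, CyclicDescent.pullbackDescent_comp i⟩
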